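/- Conventions. Let $\mathcal A$ be an abelian category and $\mathcal W$ a full additive subcategory closed under isomorphisms. A $\mathcal W$-resolution of $M$ is a complex $W=(\cdots\to W_1\to W_0)$ of objects of $\mathcal W$ with an augmentation $W_0\to M$ such that $\cdots\to W_1\to W_0\to M\to 0$ is exact; it is proper if this augmented complex stays exact under $\operatorname{Hom}_{\mathcal A}(V,-)$ for every $V\in\mathcal W$. Put $\mathcal W\text{-}\mathrm{pd}(M)=\inf_W\sup\{n\ge 0: W_n\neq 0\}$, the infimum over all $\mathcal W$-resolutions $W$ of $M$. A complex $T=(T_n)_{n\in\mathbb Z}$ of objects of $\mathcal W$ is totally $\mathcal W$-acyclic if it is exact and stays exact under $\operatorname{Hom}_{\mathcal A}(V,-)$ and $\operatorname{Hom}_{\mathcal A}(-,V)$ for every $V\in\mathcal W$; $\mathcal G(\mathcal W)$ is the subcategory of objects isomorphic to $\operatorname{Coker}(T_1\to T_0)$ for such $T$. A Tate $\mathcal W$-resolution of $M$ is a diagram $T\xrightarrow{\alpha}W\to M$ with $T$ totally $\mathcal W$-acyclic, $W\to M$ a proper $\mathcal W$-resolution, and $\alpha$ a morphism of complexes with $\alpha_n$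 an isomorphism for $n\gg 0$. If $M$ has one, set $\widehat{\operatorname{Ext}}{}^n_{\mathcal W}(M,N)=H_{-n}(\operatorname{Hom}_{\mathcal A}(T,N))$ for $n\in\mathbb Z$ and $N\in\mathcal A$; up to isomorphism this does not depend on the choice. $\widehat{\operatorname{Ext}}{}^n_{\mathcal W}(M,-)=0$ means vanishing on all objects of $\mathcal A$, and $\widehat{\operatorname{Ext}}{}^n_{\mathcal W}(-,M)=0$ means vanishing on all objects that admit a Tate $\mathcal W$-resolution. An $R$-module $C$ over a commutative ring $R$ is semidualizing if it has a (possibly infinite) resolution by free modules of finite rank, the homothety map $R\to\operatorname{Hom}_R(C,C)$ is an isomorphism, and $\operatorname{Ext}^n_R(C,C)=0$ for all $n\ge1$. $\mathcal P_C$ denotes the category of $R$-modules isomorphic to $P\otimes_R C$ with $P$ projective. **Theorem C.** Let $R$ be a commutative ring, $C$ a semidualizing $R$-module, and $M$ an $R$-module with $\mathcal G(\mathcal P_C)\text{-}\mathrm{pd}(M)<\infty$. Then $M$ admits a Tate $\mathcal P_C$-resolution, and the following conditions are equivalent: (i) $\mathcal P_C\text{-}\mathrm{pd}(M)<\infty$;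 (ii) $\widehat{\operatorname{Ext}}{}^n_{\mathcal P_C}(-,M)=0$ for each (equivalently, for some) $n\in\mathbb Z$; (iii) $\widehat{\operatorname{Ext}}{}^n_{\mathcal P_C}(M,-)=0$ for each (equivalently, for some) $n\in\mathbb Z$; (iv) $\widehat{\operatorname{Ext}}{}^0_{\mathcal P_C}(M,M)=0$. **General form.** Let $\mathcal A$ be an abelian category and $\mathcal W$ a full additive subcategory of $\mathcal A$ that is closed under direct summands, extensions and kernels of epimorphisms and satisfies $\operatorname{Ext}^n_{\mathcal A}(W,W')=0$ for all $n\ge1$ and all $W,W'\in\mathcal W$. Let $M\in\mathcal A$ satisfy $\mathcal G(\mathcal W)\text{-}\mathrm{pd}(M)<\infty$. Then $M$ admits a Tate $\mathcal W$-resolution, and the conditions (i)–(iv) with $\mathcal W$ in place of $\mathcal P_C$ are equivalent. -/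

import Mathlib

open CategoryTheory CategoryTheory.Limits CategoryTheory.Abelian Opposite
open scoped TensorProduct

universe w v u

namespace RelTate

section Abstract

variable {A : Type u} [Category.{v} A] [Abelian A]

/-- The complex `K` is `Hom(𝒳, -)`-exact: for every `X` in `𝒳` the complex of abelian groups
`Hom(X, K)` is exact. -/
def HomFromExact (𝒳 : ObjectProperty A) {ι : Type} {c : ComplexShape ι}
    (K : HomologicalComplex A c) : Prop :=
  ∀ X : A, 𝒳 X →
    (((preadditiveCoyoneda.obj (op X)).mapHomologicalComplex c).obj K).Acyclic

/-- The complex of abelian groups `Hom(K, N)`. If `K` is a homological complex indexed by `ℤ`,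
the group in degree `n` is `Hom(K_n, N)` and the differentials, given by precomposition with those
of `K`, raise `n`; in homological grading this group sits in degree `-n`. -/
noncomputable def homComplex {ι : Type} {c : ComplexShape ι} (K : HomologicalComplex A c) (N : A) :
    HomologicalComplex AddCommGrpCat.{v} c.symm :=
  ((preadditiveYoneda.obj N).mapHomologicalComplex c.symm).obj K.op

/-- The complex `K` is `Hom(-, 𝒳)`-exact: for every `X` in `𝒳` the complex of abelian groups
`Hom(K, X)` is exact. -/
def HomIntoExact (𝒳 : ObjectProperty A) {ι : Type} {c : ComplexShape ι}
    (K : HomologicalComplex A c) : Prop :=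
  ∀ X : A, 𝒳 X → (homComplex K X).Acyclic

/-- An `𝒳`-resolution of `M`: a complex `⋯ ⟶ X₁ ⟶ X₀` of objects of `𝒳` with an augmentation
`X₀ ⟶ M` such that the augmented complex `⋯ ⟶ X₁ ⟶ X₀ ⟶ M ⟶ 0` is exact. -/
structure Resolution (𝒳 : ObjectProperty A) (M : A) where
  /-- the complex of the resolution, concentrated in nonnegative degrees -/
  complex : ChainComplex A ℕ
  mem : ∀ n, 𝒳 (complex.X n)
  /-- the augmentation -/
  ε : complex.X 0 ⟶ M
  d_comp_ε : complex.d 1 0 ≫ ε = 0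
  exact : (complex.augment ε d_comp_ε).Acyclic

/-- The augmented complex `⋯ ⟶ X₁ ⟶ X₀ ⟶ M ⟶ 0`. -/
def Resolution.augmented {𝒳 : ObjectProperty A} {M : A} (X : Resolution 𝒳 M) : ChainComplex A ℕ :=
  X.complex.augment X.ε X.d_comp_ε

/-- An `𝒳`-resolution is proper if its augmented complex is `Hom(𝒳, -)`-exact. -/
def Resolution.IsProper {𝒳 : ObjectProperty A} {M : A} (X : Resolution 𝒳 M) : Prop :=
  HomFromExact 𝒳 X.augmented

/-- The length `sup {n ≥ 0 | X_n ≠ 0}` of an `𝒳`-resolution. -/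
noncomputable def Resolution.length {𝒳 : ObjectProperty A} {M : A} (X : Resolution 𝒳 M) : ℕ∞ :=
  ⨆ (n : ℕ) (_ : ¬ IsZero (X.complex.X n)), (n : ℕ∞)

/-- The `𝒳`-projective dimension of `M`: the infimum of the lengths of the `𝒳`-resolutions of `M`,
which is `⊤` if there is none. -/
noncomputable def projDim (𝒳 : ObjectProperty A) (M : A) : ℕ∞ :=
  ⨅ X : Resolution 𝒳 M, X.length

/-- `𝒳` is closed under kernels of epimorphisms. -/
def ClosedUnderKernelsOfEpis (𝒳 : ObjectProperty A) : Prop :=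
  ∀ S : ShortComplex A, S.ShortExact → 𝒳 S.X₂ → 𝒳 S.X₃ → 𝒳 S.X₁

/-- `𝒳 ⊥ 𝒴`: `Ext^n(X, Y) = 0` for all `n ≥ 1`, all `X` in `𝒳` and all `Y` in `𝒴`. -/
def Orthogonal [HasExt.{w} A] (𝒳 𝒴 : ObjectProperty A) : Prop :=
  ∀ X Y : A, 𝒳 X → 𝒴 Y → ∀ n : ℕ, 1 ≤ n → Subsingleton (Ext.{w} X Y n)

/-- Totally `𝒲`-acyclic complexes: exact complexes of objects of `𝒲` that are `Hom(𝒲, -)`-exact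
and `Hom(-, 𝒲)`-exact. -/
structure IsTotallyAcyclic (𝒲 : ObjectProperty A) (T : ChainComplex A ℤ) : Prop where
  mem : ∀ n, 𝒲 (T.X n)
  exact : T.Acyclic
  homFrom : HomFromExact 𝒲 T
  homInto : HomIntoExact 𝒲 T

/-- The subcategory `𝒢(𝒲)`: objects isomorphic to `Coker (T₁ ⟶ T₀)` for some totally
`𝒲`-acyclic complex `T`. -/
def gorenstein (𝒲 : ObjectProperty A) : ObjectProperty A := fun M =>
  ∃ T : ChainComplex A ℤ, IsTotallyAcyclic 𝒲 T ∧ Nonempty (M ≅ cokernel (T.d 1 0))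

/-- A Tate `𝒲`-resolution `T ⟶ W ⟶ M` of `M`: a totally `𝒲`-acyclic complex `T`, a proper
`𝒲`-resolution `W ⟶ M` and a morphism of complexes `α : T ⟶ W` with `α_n` an isomorphism for
`n ≫ 0`. As `W` is zero in negative degrees, `α` amounts to the maps `α_n`, `n ≥ 0`, and their
compatibility with the differentials between nonnegative degrees. -/
structure TateResolution (𝒲 : ObjectProperty A) (M : A) where
  /-- the totally acyclic complex -/
  T : ChainComplex A ℤ
  totallyAcyclic : IsTotallyAcyclic 𝒲 T
  /-- the proper resolution -/
  W : Resolution 𝒲 M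
  proper : W.IsProper
  /-- the comparison morphism `T ⟶ W` -/
  α (n : ℕ) : T.X (n : ℤ) ⟶ W.complex.X n
  comm (n : ℕ) :
    α (n + 1) ≫ W.complex.d (n + 1) n = T.d ((n + 1 : ℕ) : ℤ) (n : ℤ) ≫ α n
  eventually_isIso : ∃ N : ℕ, ∀ n : ℕ, N ≤ n → IsIso (α n)

/-- `M` admits a Tate `𝒲`-resolution. -/
class HasTateResolution (𝒲 : ObjectProperty A) (M : A) : Prop where
  nonempty : Nonempty (TateResolution 𝒲 M)

/-- A choice of a Tate `𝒲`-resolution of an object that admits one. -/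
noncomputable def tateResolution (𝒲 : ObjectProperty A) (M : A) [HasTateResolution 𝒲 M] :
    TateResolution 𝒲 M :=
  (HasTateResolution.nonempty (𝒲 := 𝒲) (M := M)).some

/-- The Tate cohomology group `Êxt^n_𝒲(M, N) = H_{-n}(Hom(T, N))`, for `n ∈ ℤ`, where
`T ⟶ W ⟶ M` is a Tate `𝒲`-resolution of `M` (any two choices give isomorphic groups). -/
noncomputable def tateExt (𝒲 : ObjectProperty A) (n : ℤ) (M N : A) [HasTateResolution 𝒲 M] :
    AddCommGrpCat.{v} :=
  (homComplex (tateResolution 𝒲 M).T N).homology n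

end Abstract

section Modules

variable (R : Type u) [CommRing R]

/-- The finitely generated free modules, i.e. the free modules of finite rank. -/
def finiteFree : ObjectProperty (ModuleCat.{u} R) := fun F =>
  Module.Free R F ∧ Module.Finite R F

variable {R}

/-- Semidualizing modules over a commutative ring. -/
structure IsSemidualizing (C : ModuleCat.{u} R) : Prop where
  /-- `C` has a (possibly unbounded) resolution by free modules of finite rank -/
  resolution : Nonempty (Resolution (finiteFree R) C)
  /-- the homothety map `R → Hom_R(C, C)` is an isomorphism -/
  homothety : Function.Bijective (fun r : R => r • (LinearMap.id : C →ₗ[R] C))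
  /-- `Ext^n_R(C, C) = 0` for `n ≥ 1` -/
  ext : ∀ n : ℕ, 1 ≤ n → Subsingleton (Ext.{u} C C n)

/-- The `C`-projective modules `𝒫_C(R)`: those isomorphic to `P ⊗_R C` with `P` projective. -/
def cProjective (C : ModuleCat.{u} R) : ObjectProperty (ModuleCat.{u} R) := fun M =>
  ∃ P : ModuleCat.{u} R, Module.Projective R P ∧ Nonempty (M ≃ₗ[R] P ⊗[R] C)

end Modules

end RelTate

/-!
Write `Z_n` for the syzygies of a complete resolution `T` of `M`. Then `Êxt^n(M, N)` is the group of
maps `Z_n ⟶ N` modulo those that factor through an object of `𝒲`, so all vanishing conditions force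
the identity of some syzygy to factor through `𝒲`. This puts one syzygy, and by total acyclicity
every syzygy of `T`, in `𝒲`; then so does a high syzygy of `M`, and `M` has a finite
`𝒲`-resolution.

For the existence of Tate resolutions, `𝒢(𝒲)` is the largest class in which every object is a
syzygy of, and has a syzygy, in the class, by sequences that are `Hom(𝒲, -)`- and
`Hom(-, 𝒲)`-exact. The horseshoe lemma shows that the extensions of objects of such a class form
such a class again, so `𝒢(𝒲)` is closed under extensions. It follows that an object with a finite
`𝒢(𝒲)`-resolution has an `n`-th syzygy in `𝒢(𝒲)` with respect to objects of `𝒲`, and the complete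
resolution of that syzygy extends to a Tate resolution.

For `𝒲 = 𝒫_C`, a resolution of `C` by free modules of finite rank carries the vanishing of
`Ext(C, C)` over to direct sums of copies of `C`, and the homothety isomorphism makes `- ⊗ C` fully
faithful on projective modules, which gives the closure of `𝒫_C` under direct summands.
-/

namespace RelTate

section HomExactness

variable {A : Type u} [Category.{v} A] [Abelian A] {ι : Type} {c : ComplexShape ι}

lemma mapPreadditiveCoyoneda_exactAt_iff (K : HomologicalComplex A c) (V : A) {i j k : ι}
    (hi : c.prev j = i) (hk : c.next j = k) :
    (((preadditiveCoyoneda.obj (op V)).mapHomologicalComplex c).obj K).ExactAt j ↔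
      ∀ f : V ⟶ K.X j, f ≫ K.d j k = 0 → ∃ g : V ⟶ K.X i, g ≫ K.d i j = f := by
  rw [HomologicalComplex.exactAt_iff' _ i j k hi hk, ShortComplex.ab_exact_iff]
  rfl

lemma homFromExact_iff (𝒳 : ObjectProperty A) (K : HomologicalComplex A c) :
    HomFromExact 𝒳 K ↔ ∀ V : A, 𝒳 V → ∀ i j k : ι, c.prev j = i → c.next j = k →
      ∀ f : V ⟶ K.X j, f ≫ K.d j k = 0 → ∃ g : V ⟶ K.X i, g ≫ K.d i j = f :=
  ⟨fun h V hV _ j _ hi hk ↦ (mapPreadditiveCoyoneda_exactAt_iff K V hi hk).1 (h V hV j),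
    fun h V hV j ↦
      (mapPreadditiveCoyoneda_exactAt_iff K V rfl rfl).2 (h V hV _ j _ rfl rfl)⟩

lemma homComplex_exactAt_iff (K : HomologicalComplex A c) (N : A) {i j k : ι}
    (hi : c.prev j = i) (hk : c.next j = k) :
    (homComplex K N).ExactAt j ↔
      ∀ f : K.X j ⟶ N, K.d i j ≫ f = 0 → ∃ g : K.X k ⟶ N, K.d j k ≫ g = f := by
  rw [HomologicalComplex.exactAt_iff' _ k j i (show c.symm.prev j = k from hk)
    (show c.symm.next j = i from hi), ShortComplex.ab_exact_iff]
  rfl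

lemma homIntoExact_iff (𝒳 : ObjectProperty A) (K : HomologicalComplex A c) :
    HomIntoExact 𝒳 K ↔ ∀ V : A, 𝒳 V → ∀ i j k : ι, c.prev j = i → c.next j = k →
      ∀ f : K.X j ⟶ V, K.d i j ≫ f = 0 → ∃ g : K.X k ⟶ V, K.d j k ≫ g = f :=
  ⟨fun h V hV _ j _ hi hk ↦ (homComplex_exactAt_iff K V hi hk).1 (h V hV j),
    fun h V hV j ↦ (homComplex_exactAt_iff K V rfl rfl).2 (h V hV _ j _ rfl rfl)⟩

end HomExactness

section SyzygySequence

variable {A : Type u} [Category.{v} A] [Abelian A] {ι : Type*} {c : ComplexShape ι}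

lemma exact_epi_comp_iff (S : ShortComplex A) {X : A} (e : X ⟶ S.X₁) [Epi e] :
    (ShortComplex.mk (e ≫ S.f) S.g (by simp)).Exact ↔ S.Exact := by
  let φ : ShortComplex.mk (e ≫ S.f) S.g (by simp) ⟶ S := { τ₁ := e, τ₂ := 𝟙 _, τ₃ := 𝟙 _ }
  have : Epi φ.τ₁ := inferInstanceAs (Epi e)
  have : IsIso φ.τ₂ := inferInstanceAs (IsIso (𝟙 _))
  have : Mono φ.τ₃ := inferInstanceAs (Mono (𝟙 _))
  exact ShortComplex.exact_iff_of_epi_of_isIso_of_mono φ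

lemma exact_comp_mono_iff (S : ShortComplex A) {X : A} (m : S.X₃ ⟶ X) [Mono m] :
    (ShortComplex.mk S.f (S.g ≫ m) (by simp)).Exact ↔ S.Exact := by
  let φ : S ⟶ ShortComplex.mk S.f (S.g ≫ m) (by simp) := { τ₁ := 𝟙 _, τ₂ := 𝟙 _, τ₃ := m }
  have : Epi φ.τ₁ := inferInstanceAs (Epi (𝟙 _))
  have : IsIso φ.τ₂ := inferInstanceAs (IsIso (𝟙 _))
  have : Mono φ.τ₃ := inferInstanceAs (Mono m)
  exact (ShortComplex.exact_iff_of_epi_of_isIso_of_mono φ).symm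

/-- The short complex `Z_i ⟶ K_j ⟶ Z_j`, where the syzygy `Z_n` is encoded as the cokernel
`K.opcycles n` of the differential arriving at `K_n`. -/
noncomputable abbrev syzygySequence (K : HomologicalComplex A c) (i j : ι) : ShortComplex A :=
  ShortComplex.mk (K.fromOpcycles i j) (K.pOpcycles j)
    (by simp only [← cancel_epi (K.pOpcycles i), HomologicalComplex.p_fromOpcycles_assoc,
      HomologicalComplex.d_pOpcycles, comp_zero])

lemma mono_fromOpcycles (K : HomologicalComplex A c) {i j : ι} (hij : c.Rel i j)
    (h : K.ExactAt i) : Mono (K.fromOpcycles i j) :=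
  Preadditive.mono_of_isZero_kernel' _ (K.homologyIsKernel i j (c.next_eq' hij))
    h.isZero_homology

lemma syzygySequence_shortExact (K : HomologicalComplex A c) {i j : ι} (hij : c.Rel i j)
    (h : K.ExactAt i) : (syzygySequence K i j).ShortExact := by
  have := mono_fromOpcycles K hij h
  have hd : (ShortComplex.mk (K.pOpcycles i ≫ K.fromOpcycles i j) (K.pOpcycles j)
      (by simp)).Exact := by
    simpa only [K.p_fromOpcycles] using
      ShortComplex.exact_of_g_is_cokernel _ (K.opcyclesIsCokernel i j (c.prev_eq' hij))
  exact { exact := (exact_epi_comp_iff (syzygySequence K i j) (K.pOpcycles i)).1 hd }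

end SyzygySequence

section FactorsThrough

variable {A : Type u} [Category.{v} A] {𝒲 : ObjectProperty A} {X Y Z : A}

/-- The morphism `f` factors through an object of `𝒲`, that is, it vanishes in the stable
category of `A` modulo `𝒲`. -/
def FactorsThrough (𝒲 : ObjectProperty A) (f : X ⟶ Y) : Prop :=
  ∃ V : A, 𝒲 V ∧ ∃ (a : X ⟶ V) (b : V ⟶ Y), a ≫ b = f

lemma factorsThrough_id (hX : 𝒲 X) : FactorsThrough 𝒲 (𝟙 X) :=
  ⟨X, hX, 𝟙 X, 𝟙 X, Category.comp_id _⟩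

namespace FactorsThrough

lemma comp_left {f : Y ⟶ Z} (hf : FactorsThrough 𝒲 f) (g : X ⟶ Y) :
    FactorsThrough 𝒲 (g ≫ f) := by
  obtain ⟨V, hV, a, b, rfl⟩ := hf
  exact ⟨V, hV, g ≫ a, b, Category.assoc ..⟩

lemma comp_right {f : X ⟶ Y} (hf : FactorsThrough 𝒲 f) (g : Y ⟶ Z) :
    FactorsThrough 𝒲 (f ≫ g) := by
  obtain ⟨V, hV, a, b, rfl⟩ := hf
  exact ⟨V, hV, a, b ≫ g, (Category.assoc ..).symm⟩

lemma prop_of_id [𝒲.IsStableUnderRetracts] (h : FactorsThrough 𝒲 (𝟙 X)) : 𝒲 X := by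
  obtain ⟨V, hV, a, b, hab⟩ := h
  exact 𝒲.prop_of_retract { i := a, r := b, retract := hab } hV

end FactorsThrough

variable [Preadditive A] [HasBinaryBiproducts A]

lemma prop_biprod [𝒲.IsClosedUnderBinaryProducts] (hX : 𝒲 X) (hY : 𝒲 Y) : 𝒲 (X ⊞ Y) :=
  𝒲.prop_of_isLimit_binaryFan (BinaryBiproduct.isLimit X Y) hX hY

lemma isClosedUnderBinaryProducts_of_biprod [𝒲.IsClosedUnderIsomorphisms]
    (h : ∀ X Y : A, 𝒲 X → 𝒲 Y → 𝒲 (X ⊞ Y)) : 𝒲.IsClosedUnderBinaryProducts where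
  limitsOfShape_le := by
    rintro Z ⟨p⟩
    refine 𝒲.prop_of_iso ?_ (h _ _ (p.prop_diag_obj (.mk .left)) (p.prop_diag_obj (.mk .right)))
    exact IsLimit.conePointUniqueUpToIso (BinaryBiproduct.isLimit _ _)
      ((IsLimit.postcomposeHomEquiv (diagramIsoPair p.diag) _).2 p.isLimit)

lemma FactorsThrough.add [𝒲.IsClosedUnderBinaryProducts] {f g : X ⟶ Y}
    (hf : FactorsThrough 𝒲 f) (hg : FactorsThrough 𝒲 g) : FactorsThrough 𝒲 (f + g) := by
  obtain ⟨V, hV, a, b, rfl⟩ := hf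
  obtain ⟨V', hV', a', b', rfl⟩ := hg
  exact ⟨V ⊞ V', prop_biprod hV hV', biprod.lift a a', biprod.desc b b', biprod.lift_desc⟩

end FactorsThrough

section StableSyzygies

variable {A : Type u} [Category.{v} A] [Preadditive A] {𝒲 : ObjectProperty A}
  {S S' : ShortComplex A}

/-- `Hom(V, S.X₂) ⟶ Hom(V, S.X₃)` is surjective for every `V` in `𝒲`. -/
def Lifts (𝒲 : ObjectProperty A) (S : ShortComplex A) : Prop :=
  ∀ V : A, 𝒲 V → ∀ f : V ⟶ S.X₃, ∃ g : V ⟶ S.X₂, g ≫ S.g = f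

/-- `Hom(S.X₂, V) ⟶ Hom(S.X₁, V)` is surjective for every `V` in `𝒲`. -/
def Extends (𝒲 : ObjectProperty A) (S : ShortComplex A) : Prop :=
  ∀ V : A, 𝒲 V → ∀ f : S.X₁ ⟶ V, ∃ g : S.X₂ ⟶ V, S.f ≫ g = f

/-- A short exact sequence `0 ⟶ X' ⟶ V ⟶ X ⟶ 0` with `V` in `𝒲` which is `Hom(𝒲, -)`-exact: it
exhibits `X'` as a syzygy of `X` in a proper `𝒲`-resolution. -/
structure IsProperSyzygy (𝒲 : ObjectProperty A) (S : ShortComplex A) : Prop where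
  shortExact : S.ShortExact
  mem : 𝒲 S.X₂
  lifts : Lifts 𝒲 S

/-- A short exact sequence `0 ⟶ X' ⟶ V ⟶ X ⟶ 0` with `V` in `𝒲` which is both `Hom(𝒲, -)`-exact
and `Hom(-, 𝒲)`-exact: these are the sequences that totally `𝒲`-acyclic complexes are spliced
from. -/
structure IsTotalSyzygy (𝒲 : ObjectProperty A) (S : ShortComplex A) : Prop
    extends IsProperSyzygy 𝒲 S where
  ext : Extends 𝒲 S

variable [Balanced A]

lemma IsProperSyzygy.exists_hom_of_τ₃ (hS' : IsProperSyzygy 𝒲 S') (hS : 𝒲 S.X₂)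
    (f : S.X₃ ⟶ S'.X₃) : ∃ φ : S ⟶ S', φ.τ₃ = f := by
  obtain ⟨g, hg⟩ := hS'.lifts _ hS (S.g ≫ f)
  have := hS'.shortExact.mono_f
  obtain ⟨s, hs⟩ := hS'.shortExact.exact.lift' (S.f ≫ g) (by simp [hg])
  exact ⟨{ τ₁ := s, τ₂ := g, τ₃ := f, comm₁₂ := hs, comm₂₃ := hg }, rfl⟩

lemma IsTotalSyzygy.exists_hom_of_τ₁ (hS : IsTotalSyzygy 𝒲 S) (hS' : 𝒲 S'.X₂)
    (f : S.X₁ ⟶ S'.X₁) : ∃ φ : S ⟶ S', φ.τ₁ = f := by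
  obtain ⟨g, hg⟩ := hS.ext _ hS' (f ≫ S'.f)
  have := hS.shortExact.epi_g
  obtain ⟨s, hs⟩ := hS.shortExact.exact.desc' (g ≫ S'.g) (by simp [reassoc_of% hg])
  exact ⟨{ τ₁ := f, τ₂ := g, τ₃ := s, comm₁₂ := hg.symm, comm₂₃ := hs.symm }, rfl⟩

lemma IsProperSyzygy.factorsThrough_τ₁ (hS' : IsProperSyzygy 𝒲 S') (hS : 𝒲 S.X₂) (φ : S ⟶ S')
    (h : FactorsThrough 𝒲 φ.τ₃) : FactorsThrough 𝒲 φ.τ₁ := by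
  obtain ⟨V, hV, a, b, hab⟩ := h
  obtain ⟨b', rfl⟩ := hS'.lifts V hV b
  have := hS'.shortExact.mono_f
  obtain ⟨s, hs⟩ := hS'.shortExact.exact.lift' (φ.τ₂ - S.g ≫ a ≫ b')
    (by simp [← hab, φ.comm₂₃])
  refine ⟨_, hS, S.f, s, ?_⟩
  rw [← cancel_mono S'.f, Category.assoc, hs]
  simp [φ.comm₁₂]

lemma IsTotalSyzygy.factorsThrough_τ₃ (hS : IsTotalSyzygy 𝒲 S) (hS' : 𝒲 S'.X₂) (φ : S ⟶ S')
    (h : FactorsThrough 𝒲 φ.τ₁) : FactorsThrough 𝒲 φ.τ₃ := by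
  obtain ⟨V, hV, a, b, hab⟩ := h
  obtain ⟨a', rfl⟩ := hS.ext V hV a
  have := hS.shortExact.epi_g
  obtain ⟨t, ht⟩ := hS.shortExact.exact.desc' (φ.τ₂ - a' ≫ b ≫ S'.f)
    (by simp [← φ.comm₁₂, ← hab, Category.assoc])
  refine ⟨_, hS', t, S'.g, ?_⟩
  rw [← cancel_epi S.g, reassoc_of% ht]
  simp [φ.comm₂₃]

lemma IsProperSyzygy.prop_τ₁ [𝒲.IsStableUnderRetracts]
    (hS : IsProperSyzygy 𝒲 S) (h : 𝒲 S.X₃) : 𝒲 S.X₁ :=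
  (hS.factorsThrough_τ₁ hS.mem (𝟙 S) (factorsThrough_id h)).prop_of_id

lemma IsTotalSyzygy.prop_τ₃ [𝒲.IsStableUnderRetracts]
    (hS : IsTotalSyzygy 𝒲 S) (h : 𝒲 S.X₁) : 𝒲 S.X₃ :=
  (hS.factorsThrough_τ₃ hS.mem (𝟙 S) (factorsThrough_id h)).prop_of_id

end StableSyzygies

section StableRetract

variable {A : Type u} [Category.{v} A] [Preadditive A] {𝒲 : ObjectProperty A}

/-- `X` is a retract of `Y` in the stable category of `A` modulo `𝒲`. -/
def StableRetract (𝒲 : ObjectProperty A) (X Y : A) : Prop :=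
  ∃ (a : X ⟶ Y) (b : Y ⟶ X), FactorsThrough 𝒲 (𝟙 X - a ≫ b)

namespace StableRetract

variable {X Y X' Y' N : A} {S S' : ShortComplex A}

lemma of_iso [𝒲.ContainsZero] (e : X ≅ Y) : StableRetract 𝒲 X Y := by
  obtain ⟨Z, -, hZ⟩ := 𝒲.exists_prop_of_containsZero
  exact ⟨e.hom, e.inv, Z, hZ, 0, 0, by simp⟩

lemma congr (h : StableRetract 𝒲 X Y) (e : X ≅ X') (e' : Y ≅ Y') :
    StableRetract 𝒲 X' Y' := by
  obtain ⟨a, b, hab⟩ := h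
  refine ⟨e.inv ≫ a ≫ e'.hom, e'.inv ≫ b ≫ e.hom, ?_⟩
  simpa using (hab.comp_left e.inv).comp_right e.hom

lemma τ₁ [Balanced A] (hS : IsProperSyzygy 𝒲 S) (hS' : IsProperSyzygy 𝒲 S')
    (h : StableRetract 𝒲 S.X₃ S'.X₃) : StableRetract 𝒲 S.X₁ S'.X₁ := by
  obtain ⟨a, b, hab⟩ := h
  obtain ⟨φ, rfl⟩ := hS'.exists_hom_of_τ₃ hS.mem a
  obtain ⟨ψ, rfl⟩ := hS.exists_hom_of_τ₃ hS'.mem b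
  exact ⟨φ.τ₁, ψ.τ₁, hS.factorsThrough_τ₁ hS.mem (𝟙 S - φ ≫ ψ) hab⟩

lemma τ₃ [Balanced A] (hS : IsTotalSyzygy 𝒲 S) (hS' : IsTotalSyzygy 𝒲 S')
    (h : StableRetract 𝒲 S.X₁ S'.X₁) : StableRetract 𝒲 S.X₃ S'.X₃ := by
  obtain ⟨a, b, hab⟩ := h
  obtain ⟨φ, rfl⟩ := hS.exists_hom_of_τ₁ hS'.mem a
  obtain ⟨ψ, rfl⟩ := hS'.exists_hom_of_τ₁ hS.mem b
  exact ⟨φ.τ₃, ψ.τ₃, hS.factorsThrough_τ₃ hS.mem (𝟙 S - φ ≫ ψ) hab⟩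

lemma factorsThrough [HasBinaryBiproducts A] [𝒲.IsClosedUnderBinaryProducts]
    (h : StableRetract 𝒲 X Y) (hY : ∀ f : Y ⟶ N, FactorsThrough 𝒲 f) (f : X ⟶ N) :
    FactorsThrough 𝒲 f := by
  obtain ⟨a, b, hab⟩ := h
  have sum_eq : a ≫ b ≫ f + (𝟙 X - a ≫ b) ≫ f = f := by simp
  exact sum_eq ▸ ((hY (b ≫ f)).comp_left a).add (hab.comp_right f)

end StableRetract

end StableRetract

section Gorenstein

variable {A : Type u} [Category.{v} A] [Abelian A] {𝒲 𝒳 : ObjectProperty A}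

lemma IsTotallyAcyclic.isTotalSyzygy {T : ChainComplex A ℤ} (hT : IsTotallyAcyclic 𝒲 T) {i j : ℤ}
    (hij : j + 1 = i) : IsTotalSyzygy 𝒲 (syzygySequence T i j) where
  shortExact := syzygySequence_shortExact T hij (hT.exact i)
  mem := hT.mem j
  lifts V hV (f : V ⟶ T.opcycles j) := by
    have hjk : (ComplexShape.down ℤ).Rel j (j - 1) := by simp
    have := mono_fromOpcycles T hjk (hT.exact j)
    obtain ⟨g, hg⟩ := (homFromExact_iff 𝒲 T).1 hT.homFrom V hV j (j - 1) (j - 1 - 1)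
      (ComplexShape.prev_eq' _ hjk) (ComplexShape.next_eq' _ (by simp))
      (f ≫ T.fromOpcycles j (j - 1)) (by simp)
    exact ⟨g, by simpa [← cancel_mono (T.fromOpcycles j (j - 1))] using hg⟩
  ext V hV (f : T.opcycles i ⟶ V) := by
    obtain ⟨g, hg⟩ := (homIntoExact_iff 𝒲 T).1 hT.homInto V hV (i + 1) i j
      (ComplexShape.prev_eq' _ rfl) (ComplexShape.next_eq' _ hij) (T.pOpcycles i ≫ f) (by simp)
    exact ⟨g, by simpa [← cancel_epi (T.pOpcycles i)] using hg⟩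

section Splicing

variable {T : ChainComplex A ℤ} {K : ℤ → A} {p : ∀ n, T.X n ⟶ K n} {m : ∀ n, K (n + 1) ⟶ T.X n}
  {w : ∀ n, m n ≫ p n = 0}

lemma acyclic_of_splice (hd : ∀ n, p (n + 1) ≫ m n = T.d (n + 1) n)
    (h : ∀ n, (ShortComplex.mk (m n) (p n) (w n)).ShortExact) : T.Acyclic := by
  intro j
  obtain ⟨k, rfl⟩ : ∃ k, j = k + 1 := ⟨j - 1, by simp⟩
  rw [HomologicalComplex.exactAt_iff' _ (k + 1 + 1) (k + 1) k (by simp) (by simp)]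
  have := (h k).mono_f
  have := (h (k + 1 + 1)).epi_g
  have exact_pm := (exact_comp_mono_iff _ (m k)).2
    ((exact_epi_comp_iff _ (p (k + 1 + 1))).2 (h (k + 1)).exact)
  simp only [hd] at exact_pm
  exact exact_pm

lemma isTotallyAcyclic_of_splice (hd : ∀ n, p (n + 1) ≫ m n = T.d (n + 1) n)
    (h : ∀ n, IsTotalSyzygy 𝒲 (ShortComplex.mk (m n) (p n) (w n))) :
    IsTotallyAcyclic 𝒲 T := by
  have hm (n) : Mono (m n) := (h n).shortExact.mono_f
  have hp (n) : Epi (p n) := (h n).shortExact.epi_g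
  refine ⟨fun n ↦ (h n).mem, acyclic_of_splice hd fun n ↦ (h n).shortExact, ?_, ?_⟩
  · rw [homFromExact_iff]
    rintro V hV _ j k rfl hk f hf
    obtain rfl : j = k + 1 := by rw [ChainComplex.next] at hk; lia
    rw [ChainComplex.prev]
    have hfp : f ≫ p (k + 1) = 0 := by
      rw [← cancel_mono (m k), Category.assoc, hd, hf, zero_comp]
    obtain ⟨x, hx⟩ := (h (k + 1)).shortExact.exact.lift' f hfp
    obtain ⟨y, hy⟩ := (h (k + 1 + 1)).lifts V hV x
    exact ⟨y, by rw [← hd, reassoc_of% hy, hx]⟩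
  · rw [homIntoExact_iff]
    rintro V hV _ j k rfl hk f
    obtain rfl : j = k + 1 := by rw [ChainComplex.next] at hk; lia
    rw [ChainComplex.prev]
    intro hf
    have hmf : m (k + 1) ≫ f = 0 := by
      rw [← cancel_epi (p (k + 1 + 1)), reassoc_of% (hd (k + 1)), hf, comp_zero]
    obtain ⟨x, hx⟩ := (h (k + 1)).shortExact.exact.desc' f hmf
    obtain ⟨y, hy⟩ := (h k).ext V hV x
    exact ⟨y, by rw [← hd, Category.assoc, hy, hx]⟩

end Splicing

lemma nonempty_iso_cokernel {S : ShortComplex A} (hS : S.ShortExact) {X : A} (d : X ⟶ S.X₂)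
    (q : X ⟶ S.X₁) [Epi q] (hd : q ≫ S.f = d) : Nonempty (S.X₃ ≅ cokernel d) := by
  subst hd
  have := hS.epi_g
  exact ⟨(isCokernelEpiComp hS.gIsCokernel q rfl).coconePointUniqueUpToIso (colimit.isColimit _)⟩

lemma gorenstein_of_isTotalSyzygy {K V : ℤ → A} {m : ∀ n, K (n + 1) ⟶ V n} {p : ∀ n, V n ⟶ K n}
    {w : ∀ n, m n ≫ p n = 0}
    (h : ∀ n, IsTotalSyzygy 𝒲 (ShortComplex.mk (m n) (p n) (w n))) : gorenstein 𝒲 (K 0) := by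
  let T : ChainComplex A ℤ := ChainComplex.of V (fun n ↦ p (n + 1) ≫ m n)
    fun n ↦ by rw [Category.assoc, reassoc_of% w (n + 1), zero_comp, comp_zero]
  have hd (n : ℤ) : p (n + 1) ≫ m n = T.d (n + 1) n :=
    (ChainComplex.of_d V (fun n ↦ p (n + 1) ≫ m n) n).symm
  have := (h 1).shortExact.epi_g
  exact ⟨T, isTotallyAcyclic_of_splice hd h,
    nonempty_iso_cokernel (h 0).shortExact (T.d 1 0) (p 1) (hd 0)⟩

/-- A class `𝒳` of objects is syzygy closed if each of its objects `X` is both the last and the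
first term of a sequence in the sense of `IsTotalSyzygy` whose other end is again in `𝒳`. The class
`𝒢(𝒲)` is the largest one. -/
structure IsSyzygyClosed (𝒲 𝒳 : ObjectProperty A) : Prop where
  left (X : A) (hX : 𝒳 X) : ∃ (K V : A) (i : K ⟶ V) (p : V ⟶ X) (w : i ≫ p = 0),
    𝒳 K ∧ IsTotalSyzygy 𝒲 (ShortComplex.mk i p w)
  right (X : A) (hX : 𝒳 X) : ∃ (V K : A) (i : X ⟶ V) (p : V ⟶ K) (w : i ≫ p = 0),
    𝒳 K ∧ IsTotalSyzygy 𝒲 (ShortComplex.mk i p w)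

theorem IsSyzygyClosed.le_gorenstein (h : IsSyzygyClosed 𝒲 𝒳) : 𝒳 ≤ gorenstein 𝒲 := by
  intro X hX
  choose L _ _ _ _ mem_L total_L using h.left
  choose _ R _ _ _ mem_R total_R using h.right
  let l : ℕ → Subtype 𝒳 := Nat.rec ⟨X, hX⟩ fun _ Y ↦ ⟨L Y.1 Y.2, mem_L Y.1 Y.2⟩
  let r : ℕ → Subtype 𝒳 := Nat.rec ⟨X, hX⟩ fun _ Y ↦ ⟨R Y.1 Y.2, mem_R Y.1 Y.2⟩
  let K : ℤ → A
    | Int.ofNat n => (l n).1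
    | Int.negSucc n => (r (n + 1)).1
  have total (n : ℤ) : ∃ (V : A) (m : K (n + 1) ⟶ V) (p : V ⟶ K n) (w : m ≫ p = 0),
      IsTotalSyzygy 𝒲 (ShortComplex.mk m p w) := by
    rcases n with n | _ | n
    · exact ⟨_, _, _, _, total_L (l n).1 (l n).2⟩
    · exact ⟨_, _, _, _, total_R X hX⟩
    · exact ⟨_, _, _, _, total_R (r (n + 1)).1 (r (n + 1)).2⟩
  choose V m p w h using total
  exact gorenstein_of_isTotalSyzygy h

instance : (gorenstein 𝒲).IsClosedUnderIsomorphisms where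
  of_iso := fun e ⟨T, hT, ⟨eT⟩⟩ ↦ ⟨T, hT, ⟨e.symm ≪≫ eT⟩⟩

/-- The complex `T` reindexed, without signs, so that `T_k` sits in degree `0`. -/
@[simps]
def reindex (T : ChainComplex A ℤ) (k : ℤ) : ChainComplex A ℤ where
  X n := T.X (n + k)
  d i j := T.d (i + k) (j + k)
  shape i j hij := T.shape _ _ fun (h : j + k + 1 = i + k) ↦ hij (by
    change j + 1 = i
    lia)

lemma IsTotallyAcyclic.reindex {T : ChainComplex A ℤ} (hT : IsTotallyAcyclic 𝒲 T) (k : ℤ) :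
    IsTotallyAcyclic 𝒲 (reindex T k) where
  mem n := hT.mem (n + k)
  exact n := by
    have h := hT.exact (n + k)
    rw [HomologicalComplex.exactAt_iff' _ (n + 1 + k) (n + k) (n - 1 + k) (by simp; lia)
      (by simp; lia)] at h
    rwa [HomologicalComplex.exactAt_iff' _ (n + 1) n (n - 1) (by simp) (by simp)]
  homFrom := by
    rw [homFromExact_iff]
    rintro V hV _ j _ rfl rfl
    exact (homFromExact_iff 𝒲 T).1 hT.homFrom V hV _ (j + k) _ (by simp; lia) (by simp; lia)
  homInto := by
    rw [homIntoExact_iff]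
    rintro V hV _ j _ rfl rfl
    exact (homIntoExact_iff 𝒲 T).1 hT.homInto V hV _ (j + k) _ (by simp; lia) (by simp; lia)

lemma IsTotallyAcyclic.gorenstein_opcycles {T : ChainComplex A ℤ} (hT : IsTotallyAcyclic 𝒲 T)
    (j : ℤ) : gorenstein 𝒲 (T.opcycles j) := by
  have h : gorenstein 𝒲 (T.opcycles (0 + j)) :=
    ⟨RelTate.reindex T j, hT.reindex j,
      ⟨(T.opcyclesIsCokernel (1 + j) (0 + j) (by simp; lia)).coconePointUniqueUpToIso
        (colimit.isColimit _)⟩⟩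
  rwa [zero_add] at h

lemma exists_iso_opcycles_zero {X : A} (hX : gorenstein 𝒲 X) :
    ∃ T : ChainComplex A ℤ, IsTotallyAcyclic 𝒲 T ∧ Nonempty (X ≅ T.opcycles 0) := by
  obtain ⟨T, hT, ⟨e⟩⟩ := hX
  exact ⟨T, hT, ⟨e ≪≫ (cokernelIsCokernel _).coconePointUniqueUpToIso
    (T.opcyclesIsCokernel 1 0 (by simp))⟩⟩

lemma IsTotalSyzygy.of_iso_left {S : ShortComplex A} (hS : IsTotalSyzygy 𝒲 S) {X : A}
    (e : X ≅ S.X₁) : IsTotalSyzygy 𝒲 (ShortComplex.mk (e.hom ≫ S.f) S.g (by simp)) where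
  shortExact := ShortComplex.shortExact_of_iso
    (ShortComplex.isoMk e.symm (Iso.refl _) (Iso.refl _)) hS.shortExact
  mem := hS.mem
  lifts := hS.lifts
  ext V hV f := by
    obtain ⟨g, hg⟩ := hS.ext V hV (e.inv ≫ f)
    exact ⟨g, by simp [hg]⟩

lemma IsTotalSyzygy.of_iso_right {S : ShortComplex A} (hS : IsTotalSyzygy 𝒲 S) {X : A}
    (e : S.X₃ ≅ X) : IsTotalSyzygy 𝒲 (ShortComplex.mk S.f (S.g ≫ e.hom) (by simp)) where
  shortExact := ShortComplex.shortExact_of_iso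
    (ShortComplex.isoMk (S₁ := S) (Iso.refl _) (Iso.refl _) e) hS.shortExact
  mem := hS.mem
  ext := hS.ext
  lifts V hV f := by
    obtain ⟨g, hg⟩ := hS.lifts V hV (f ≫ e.inv)
    exact ⟨g, by simp [reassoc_of% hg]⟩

theorem isSyzygyClosed_gorenstein : IsSyzygyClosed 𝒲 (gorenstein 𝒲) where
  left X hX := by
    obtain ⟨T, hT, ⟨e⟩⟩ := exists_iso_opcycles_zero hX
    exact ⟨_, _, _, _, _, hT.gorenstein_opcycles 1,
      (hT.isTotalSyzygy (zero_add 1)).of_iso_right e.symm⟩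
  right X hX := by
    obtain ⟨T, hT, ⟨e⟩⟩ := exists_iso_opcycles_zero hX
    exact ⟨_, _, _, _, _, hT.gorenstein_opcycles (-1),
      (hT.isTotalSyzygy (neg_add_cancel 1)).of_iso_left e⟩

end Gorenstein

section Ext

variable {A : Type u} [Category.{v} A] [Abelian A] [HasExt.{w} A]

lemma subsingleton_ext_of_retract_left {X X' Y : A} {n : ℕ} (h : Subsingleton (Ext.{w} X Y n))
    (r : Retract X' X) : Subsingleton (Ext.{w} X' Y n) := by
  refine subsingleton_of_forall_eq 0 fun x ↦ ?_
  have retract_comp :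
      (Ext.mk₀ r.i).comp ((Ext.mk₀ r.r).comp x (zero_add n)) (zero_add n) = x := by
    rw [Ext.mk₀_comp_mk₀_assoc, r.retract, Ext.mk₀_id_comp]
  rw [← retract_comp, h.elim ((Ext.mk₀ r.r).comp x _) 0, Ext.comp_zero]

lemma subsingleton_ext_of_retract_right {X Y Y' : A} {n : ℕ} (h : Subsingleton (Ext.{w} X Y n))
    (r : Retract Y' Y) : Subsingleton (Ext.{w} X Y' n) := by
  refine subsingleton_of_forall_eq 0 fun x ↦ ?_
  have comp_retract :
      (x.comp (Ext.mk₀ r.i) (add_zero n)).comp (Ext.mk₀ r.r) (add_zero n) = x := by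
    rw [Ext.comp_assoc_of_third_deg_zero, Ext.mk₀_comp_mk₀, r.retract, Ext.comp_mk₀_id]
  rw [← comp_retract, h.elim (x.comp (Ext.mk₀ r.i) _) 0, Ext.zero_comp]

variable {S : ShortComplex A} (hS : S.ShortExact) {X Y : A} {n : ℕ}

include hS

lemma subsingleton_ext_X₁ (h₃ : Subsingleton (Ext.{w} X S.X₃ n))
    (h₂ : Subsingleton (Ext.{w} X S.X₂ (n + 1))) : Subsingleton (Ext.{w} X S.X₁ (n + 1)) := by
  refine subsingleton_of_forall_eq 0 fun x ↦ ?_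
  obtain ⟨y, rfl⟩ := Ext.covariant_sequence_exact₁ X hS x (h₂.elim _ _) rfl
  rw [h₃.elim y 0, Ext.zero_comp]

lemma subsingleton_ext_X₂ (h₁ : Subsingleton (Ext.{w} X S.X₁ n))
    (h₃ : Subsingleton (Ext.{w} X S.X₃ n)) : Subsingleton (Ext.{w} X S.X₂ n) := by
  refine subsingleton_of_forall_eq 0 fun x ↦ ?_
  obtain ⟨y, rfl⟩ := Ext.covariant_sequence_exact₂ X hS x (h₃.elim _ _)
  rw [h₁.elim y 0, Ext.zero_comp]

lemma subsingleton_ext_X₃ (h₂ : Subsingleton (Ext.{w} X S.X₂ n))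
    (h₁ : Subsingleton (Ext.{w} X S.X₁ (n + 1))) : Subsingleton (Ext.{w} X S.X₃ n) := by
  refine subsingleton_of_forall_eq 0 fun x ↦ ?_
  obtain ⟨y, rfl⟩ := Ext.covariant_sequence_exact₃ X hS x rfl (h₁.elim _ _)
  rw [h₂.elim y 0, Ext.zero_comp]

lemma subsingleton_ext_of_X₁ (h₂ : Subsingleton (Ext.{w} S.X₂ Y n))
    (h₃ : Subsingleton (Ext.{w} S.X₃ Y (n + 1))) : Subsingleton (Ext.{w} S.X₁ Y n) := by
  refine subsingleton_of_forall_eq 0 fun x ↦ ?_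
  obtain ⟨y, rfl⟩ := Ext.contravariant_sequence_exact₁ hS Y x (add_comm _ _) (h₃.elim _ _)
  rw [h₂.elim y 0, Ext.comp_zero]

lemma subsingleton_ext_of_X₂ (h₁ : Subsingleton (Ext.{w} S.X₁ Y n))
    (h₃ : Subsingleton (Ext.{w} S.X₃ Y n)) : Subsingleton (Ext.{w} S.X₂ Y n) := by
  refine subsingleton_of_forall_eq 0 fun x ↦ ?_
  obtain ⟨y, rfl⟩ := Ext.contravariant_sequence_exact₂ hS Y x (h₁.elim _ _)
  rw [h₃.elim y 0, Ext.comp_zero]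

lemma subsingleton_ext_of_X₃ (h₁ : Subsingleton (Ext.{w} S.X₁ Y n))
    (h₂ : Subsingleton (Ext.{w} S.X₂ Y (n + 1))) : Subsingleton (Ext.{w} S.X₃ Y (n + 1)) := by
  refine subsingleton_of_forall_eq 0 fun x ↦ ?_
  obtain ⟨y, rfl⟩ := Ext.contravariant_sequence_exact₃ hS Y x (h₂.elim _ _) (add_comm _ _)
  rw [h₁.elim y 0, Ext.comp_zero]

lemma exists_lift_of_ext_one (h₁ : Subsingleton (Ext.{w} X S.X₁ 1)) (f : X ⟶ S.X₃) :
    ∃ g : X ⟶ S.X₂, g ≫ S.g = f := by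
  obtain ⟨y, hy⟩ := Ext.covariant_sequence_exact₃ X hS (Ext.mk₀ f) (zero_add 1) (h₁.elim _ _)
  obtain ⟨g, rfl⟩ := (Ext.mk₀_bijective _ _).2 y
  exact ⟨g, (Ext.mk₀_bijective _ _).1 (by rw [← hy, Ext.mk₀_comp_mk₀])⟩

lemma exists_extension_of_ext_one (h₃ : Subsingleton (Ext.{w} S.X₃ Y 1)) (f : S.X₁ ⟶ Y) :
    ∃ g : S.X₂ ⟶ Y, S.f ≫ g = f := by
  obtain ⟨y, hy⟩ := Ext.contravariant_sequence_exact₁ hS Y (Ext.mk₀ f) (add_zero 1) (h₃.elim _ _)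
  obtain ⟨g, rfl⟩ := (Ext.mk₀_bijective _ _).2 y
  exact ⟨g, (Ext.mk₀_bijective _ _).1 (by rw [← hy, Ext.mk₀_comp_mk₀])⟩

lemma subsingleton_ext_one_X₁ (h : ∀ f : X ⟶ S.X₃, ∃ g : X ⟶ S.X₂, g ≫ S.g = f)
    (h₂ : Subsingleton (Ext.{w} X S.X₂ 1)) : Subsingleton (Ext.{w} X S.X₁ 1) := by
  refine subsingleton_of_forall_eq 0 fun x ↦ ?_
  obtain ⟨y, rfl⟩ := Ext.covariant_sequence_exact₁ X hS x (h₂.elim _ _) (zero_add 1)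
  obtain ⟨f, rfl⟩ := (Ext.mk₀_bijective _ _).2 y
  obtain ⟨g, rfl⟩ := h f
  rw [← Ext.mk₀_comp_mk₀, Ext.comp_assoc_of_second_deg_zero, hS.comp_extClass, Ext.comp_zero]

lemma subsingleton_ext_one_of_X₃ (h : ∀ f : S.X₁ ⟶ Y, ∃ g : S.X₂ ⟶ Y, S.f ≫ g = f)
    (h₂ : Subsingleton (Ext.{w} S.X₂ Y 1)) : Subsingleton (Ext.{w} S.X₃ Y 1) := by
  refine subsingleton_of_forall_eq 0 fun x ↦ ?_
  obtain ⟨y, rfl⟩ := Ext.contravariant_sequence_exact₃ hS Y x (h₂.elim _ _) (add_zero 1)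
  obtain ⟨f, rfl⟩ := (Ext.mk₀_bijective _ _).2 y
  obtain ⟨g, rfl⟩ := h f
  rw [← Ext.mk₀_comp_mk₀, ← Ext.comp_assoc_of_second_deg_zero, hS.extClass_comp, Ext.zero_comp]

end Ext

section Horseshoe

variable {A : Type u} [Category.{v} A] [Abelian A]

/-- The snake diagram of a morphism of short exact sequences. -/
noncomputable def snakeInput {R S : ShortComplex A} (φ : R ⟶ S) (hR : R.ShortExact)
    (hS : S.ShortExact) : ShortComplex.SnakeInput A where
  L₀ := kernel φ
  L₁ := R
  L₂ := S
  L₃ := cokernel φ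
  v₀₁ := kernel.ι φ
  v₁₂ := φ
  v₂₃ := cokernel.π φ
  h₀ := kernelIsKernel φ
  h₃ := cokernelIsCokernel φ
  L₁_exact := hR.exact
  epi_L₁_g := hR.epi_g
  L₂_exact := hS.exact
  mono_L₂_f := hS.mono_f

lemma snakeInput_L₀_shortExact {R S : ShortComplex A} (φ : R ⟶ S) (hR : R.ShortExact)
    (hS : S.ShortExact) [Epi φ.τ₁] : (snakeInput φ hR hS).L₀.ShortExact := by
  let D := snakeInput φ hR hS
  have : Epi D.v₁₂.τ₁ := inferInstanceAs (Epi φ.τ₁)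
  have isZero : IsZero D.L₃.X₁ := IsZero.of_epi_eq_zero D.v₂₃.τ₁
    (by rw [← cancel_epi D.v₁₂.τ₁, D.w₁₃_τ₁, comp_zero])
  have : Mono D.L₁.f := hR.mono_f
  exact .mk' D.L₀_exact inferInstance (D.L₁'_exact.epi_f (isZero.eq_of_tgt _ _))

lemma snakeInput_L₃_shortExact {R S : ShortComplex A} (φ : R ⟶ S) (hR : R.ShortExact)
    (hS : S.ShortExact) [Mono φ.τ₃] : (snakeInput φ hR hS).L₃.ShortExact := by
  let D := snakeInput φ hR hS
  have : Mono D.v₁₂.τ₃ := inferInstanceAs (Mono φ.τ₃)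
  have isZero : IsZero D.L₀.X₃ := IsZero.of_mono_eq_zero D.v₀₁.τ₃
    (by rw [← cancel_mono D.v₁₂.τ₃, D.w₀₂_τ₃, zero_comp])
  have : Epi D.L₂.g := hS.epi_g
  exact .mk' D.L₃_exact (D.L₂'_exact.mono_g (isZero.eq_of_src _ _)) inferInstance

lemma exists_shortExact_of_iso {S : ShortComplex A} (hS : S.ShortExact) {X Z : A}
    (e₁ : S.X₁ ≅ X) (e₃ : S.X₃ ≅ Z) : ∃ (f : X ⟶ S.X₂) (g : S.X₂ ⟶ Z) (w : f ≫ g = 0),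
      (ShortComplex.mk f g w).ShortExact :=
  ⟨e₁.inv ≫ S.f, S.g ≫ e₃.hom, by simp,
    ShortComplex.shortExact_of_iso (ShortComplex.isoMk e₁ (Iso.refl _) e₃) hS⟩

variable {S : ShortComplex A} (hS : S.ShortExact) {K₁ V₁ K₃ V₃ : A}

include hS

theorem exists_horseshoe {i₁ : K₁ ⟶ V₁} {p₁ : V₁ ⟶ S.X₁} {w₁ : i₁ ≫ p₁ = 0}
    (h₁ : (ShortComplex.mk i₁ p₁ w₁).ShortExact) {i₃ : K₃ ⟶ V₃} {p₃ : V₃ ⟶ S.X₃} {w₃ : i₃ ≫ p₃ = 0}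
    (h₃ : (ShortComplex.mk i₃ p₃ w₃).ShortExact) (l : V₃ ⟶ S.X₂) (hl : l ≫ S.g = p₃) :
    ∃ (K : A) (i : K ⟶ V₁ ⊞ V₃) (p : V₁ ⊞ V₃ ⟶ S.X₂) (w : i ≫ p = 0),
      (ShortComplex.mk i p w).ShortExact ∧
      ∃ (f : K₁ ⟶ K) (g : K ⟶ K₃) (w : f ≫ g = 0), (ShortComplex.mk f g w).ShortExact := by
  let φ : ShortComplex.mk (biprod.inl : V₁ ⟶ V₁ ⊞ V₃) biprod.snd biprod.inl_snd ⟶ S :=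
    { τ₁ := p₁, τ₂ := biprod.desc (p₁ ≫ S.f) l, τ₃ := p₃
      comm₁₂ := by simp
      comm₂₃ := by ext <;> simp [hl] }
  have hV := (ShortComplex.Splitting.ofHasBinaryBiproduct V₁ V₃).shortExact
  let D := snakeInput φ hV hS
  have epi₁ : Epi φ.τ₁ := h₁.epi_g
  have epi₃ : Epi φ.τ₃ := h₃.epi_g
  have epi₂ : Epi φ.τ₂ := ShortComplex.epi_of_epi_of_epi_of_epi φ hS.exact hV.epi_g epi₁ epi₃
  exact ⟨D.L₀.X₂, D.v₀₁.τ₂, φ.τ₂, D.w₀₂_τ₂, .mk' D.exact_C₂_up D.mono_v₀₁_τ₂ epi₂,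
    exists_shortExact_of_iso (snakeInput_L₀_shortExact φ hV hS)
      (D.h₀τ₁.conePointUniqueUpToIso h₁.fIsKernel) (D.h₀τ₃.conePointUniqueUpToIso h₃.fIsKernel)⟩

theorem exists_cohorseshoe {i₁ : S.X₁ ⟶ V₁} {p₁ : V₁ ⟶ K₁} {w₁ : i₁ ≫ p₁ = 0}
    (h₁ : (ShortComplex.mk i₁ p₁ w₁).ShortExact) {i₃ : S.X₃ ⟶ V₃} {p₃ : V₃ ⟶ K₃} {w₃ : i₃ ≫ p₃ = 0}
    (h₃ : (ShortComplex.mk i₃ p₃ w₃).ShortExact) (l : S.X₂ ⟶ V₁) (hl : S.f ≫ l = i₁) :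
    ∃ (K : A) (i : S.X₂ ⟶ V₁ ⊞ V₃) (p : V₁ ⊞ V₃ ⟶ K) (w : i ≫ p = 0),
      (ShortComplex.mk i p w).ShortExact ∧
      ∃ (f : K₁ ⟶ K) (g : K ⟶ K₃) (w : f ≫ g = 0), (ShortComplex.mk f g w).ShortExact := by
  let φ : S ⟶ ShortComplex.mk (biprod.inl : V₁ ⟶ V₁ ⊞ V₃) biprod.snd biprod.inl_snd :=
    { τ₁ := i₁, τ₂ := biprod.lift l (S.g ≫ i₃), τ₃ := i₃
      comm₁₂ := by ext <;> simp [hl]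
      comm₂₃ := by simp }
  have hV := (ShortComplex.Splitting.ofHasBinaryBiproduct V₁ V₃).shortExact
  let D := snakeInput φ hS hV
  have mono₁ : Mono φ.τ₁ := h₁.mono_f
  have mono₃ : Mono φ.τ₃ := h₃.mono_f
  have mono₂ : Mono φ.τ₂ :=
    ShortComplex.mono_of_mono_of_mono_of_mono φ hS.exact hV.mono_f mono₁ mono₃
  exact ⟨D.L₃.X₂, φ.τ₂, D.v₂₃.τ₂, D.w₁₃_τ₂, .mk' D.exact_C₂_down mono₂ D.epi_v₂₃_τ₂,
    exists_shortExact_of_iso (snakeInput_L₃_shortExact φ hS hV)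
      (D.h₃τ₁.coconePointUniqueUpToIso h₁.gIsCokernel)
      (D.h₃τ₃.coconePointUniqueUpToIso h₃.gIsCokernel)⟩

omit hS

lemma exists_kernel_comp {K V X L G : A} {i : K ⟶ V} {p : V ⟶ X} {w₁ : i ≫ p = 0}
    (h₁ : (ShortComplex.mk i p w₁).ShortExact) {j : L ⟶ X} {q : X ⟶ G} {w₂ : j ≫ q = 0}
    (h₂ : (ShortComplex.mk j q w₂).ShortExact) :
    ∃ (N : A) (k : N ⟶ V) (w : k ≫ p ≫ q = 0), (ShortComplex.mk k (p ≫ q) w).ShortExact ∧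
      ∃ (f : K ⟶ N) (g : N ⟶ L) (w : f ≫ g = 0), (ShortComplex.mk f g w).ShortExact := by
  have := h₁.mono_f
  have := h₂.mono_f
  have := h₁.epi_g
  have := h₂.epi_g
  let N := kernel (p ≫ q)
  let k : N ⟶ V := kernel.ι (p ≫ q)
  have hk : (ShortComplex.mk k (p ≫ q) (kernel.condition _)).ShortExact :=
    .mk' (ShortComplex.exact_kernel _) inferInstance inferInstance
  obtain ⟨f, hf : f ≫ k = i⟩ := hk.exact.lift' i (by simp [reassoc_of% w₁])
  obtain ⟨g, hg : g ≫ j = k ≫ p⟩ := h₂.exact.lift' (k ≫ p) (by simp [k])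
  have w : f ≫ g = 0 := by rw [← cancel_mono j, Category.assoc, hg, reassoc_of% hf, w₁, zero_comp]
  have mono_f : Mono f := mono_of_mono_fac hf
  have epi_g : Epi g := (epi_iff_surjective_up_to_refinements g).2 fun B y ↦ by
    obtain ⟨B', π, hπ, x, hx⟩ := surjective_up_to_refinements_of_epi p (y ≫ j)
    have hxq : x ≫ p ≫ q = 0 := by rw [← reassoc_of% hx, w₂, comp_zero, comp_zero]
    refine ⟨B', π, hπ, kernel.lift (p ≫ q) x hxq, ?_⟩
    rw [← cancel_mono j, Category.assoc, Category.assoc, hg, kernel.lift_ι_assoc, hx]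
  have lift_comp_p {B : A} (x : B ⟶ N) (hx : x ≫ g = 0) : (x ≫ k) ≫ p = 0 := by
    rw [Category.assoc, ← hg, reassoc_of% hx, zero_comp]
  have exact_fg : (ShortComplex.mk f g w).Exact := ShortComplex.exact_of_f_is_kernel _ <|
    KernelFork.IsLimit.ofι' _ _ fun x hx ↦
      ⟨h₁.exact.lift (x ≫ k) (lift_comp_p x hx), by
        rw [← cancel_mono k, Category.assoc, hf]
        exact h₁.exact.lift_f _ _⟩
  exact ⟨N, k, _, hk, f, g, w, .mk' exact_fg mono_f epi_g⟩

end Horseshoe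

section Orthogonality

variable {A : Type u} [Category.{v} A] [Abelian A] {𝒲 𝒳 𝒴 𝒵 : ObjectProperty A}

/-- The class of extensions of an object of `𝒵` by an object of `𝒳`. -/
def extensions (𝒳 𝒵 : ObjectProperty A) : ObjectProperty A := fun Y ↦
  ∃ (X Z : A) (f : X ⟶ Y) (g : Y ⟶ Z) (w : f ≫ g = 0),
    𝒳 X ∧ 𝒵 Z ∧ (ShortComplex.mk f g w).ShortExact

/-- The class of objects having an `n`-th syzygy in `𝒳`, where the syzygies are taken with respect
to epimorphisms from objects of `𝒲`. -/
def nthSyzygyIn (𝒲 𝒳 : ObjectProperty A) : ℕ → ObjectProperty A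
  | 0 => 𝒳
  | n + 1 => fun X ↦ ∃ (K V : A) (i : K ⟶ V) (p : V ⟶ X) (w : i ≫ p = 0),
      nthSyzygyIn 𝒲 𝒳 n K ∧ 𝒲 V ∧ (ShortComplex.mk i p w).ShortExact

instance [𝒳.IsClosedUnderIsomorphisms] (n : ℕ) :
    (nthSyzygyIn 𝒲 𝒳 n).IsClosedUnderIsomorphisms where
  of_iso {X Y} e hX := by
    cases n with
    | zero => exact 𝒳.prop_of_iso e hX
    | succ n =>
      obtain ⟨K, V, i, p, w, hK, hV, hS⟩ := hX
      exact ⟨K, V, i, p ≫ e.hom, by rw [reassoc_of% w, zero_comp], hK, hV,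
        ShortComplex.shortExact_of_iso
          (ShortComplex.isoMk (S₁ := .mk i p w) (Iso.refl _) (Iso.refl _) e) hS⟩

variable [HasExt.{w} A]

lemma orthogonal_iff : Orthogonal.{w} 𝒳 𝒴 ↔
    ∀ X Y : A, 𝒳 X → 𝒴 Y → ∀ n : ℕ, Subsingleton (Ext.{w} X Y (n + 1)) := by
  refine ⟨fun h X Y hX hY n ↦ h X Y hX hY (n + 1) (by lia), fun h X Y hX hY n hn ↦ ?_⟩
  obtain ⟨n, rfl⟩ : ∃ k, n = k + 1 := ⟨n - 1, by lia⟩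
  exact h X Y hX hY n

namespace Orthogonal

lemma extensions_left (hX : Orthogonal.{w} 𝒳 𝒴) (hZ : Orthogonal.{w} 𝒵 𝒴) :
    Orthogonal.{w} (extensions 𝒳 𝒵) 𝒴 := by
  rintro _ Y ⟨X, Z, _, _, _, mem_X, mem_Z, hS⟩ mem_Y n hn
  exact subsingleton_ext_of_X₂ hS (hX X Y mem_X mem_Y n hn) (hZ Z Y mem_Z mem_Y n hn)

lemma extensions_right (hX : Orthogonal.{w} 𝒴 𝒳) (hZ : Orthogonal.{w} 𝒴 𝒵) :
    Orthogonal.{w} 𝒴 (extensions 𝒳 𝒵) := by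
  rintro Y _ mem_Y ⟨X, Z, _, _, _, mem_X, mem_Z, hS⟩ n hn
  exact subsingleton_ext_X₂ hS (hX Y X mem_Y mem_X n hn) (hZ Y Z mem_Y mem_Z n hn)

lemma nthSyzygyIn_right (h𝒲 : Orthogonal.{w} 𝒴 𝒲) (h𝒳 : Orthogonal.{w} 𝒴 𝒳) (n : ℕ) :
    Orthogonal.{w} 𝒴 (nthSyzygyIn 𝒲 𝒳 n) := by
  induction n with
  | zero => exact h𝒳
  | succ n ih =>
    rintro Y _ mem_Y ⟨K, V, _, _, _, mem_K, mem_V, hS⟩ k hk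
    exact subsingleton_ext_X₃ hS (h𝒲 Y V mem_Y mem_V k hk) (ih Y K mem_Y mem_K (k + 1) (by lia))

lemma isSyzygyClosed_left (hO : Orthogonal.{w} 𝒲 𝒲) (h𝒳 : IsSyzygyClosed 𝒲 𝒳) :
    Orthogonal.{w} 𝒳 𝒲 := by
  refine orthogonal_iff.2 fun X V mem_X mem_V n ↦ ?_
  induction n generalizing X with
  | zero =>
    obtain ⟨K, _, _, _, _, -, hS⟩ := h𝒳.left X mem_X
    exact subsingleton_ext_one_of_X₃ hS.shortExact (hS.ext V mem_V) (hO _ _ hS.mem mem_V 1 le_rfl)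
  | succ n ih =>
    obtain ⟨K, _, _, _, _, mem_K, hS⟩ := h𝒳.left X mem_X
    exact subsingleton_ext_of_X₃ hS.shortExact (ih K mem_K) (hO _ _ hS.mem mem_V _ (by lia))

lemma isSyzygyClosed_right (hO : Orthogonal.{w} 𝒲 𝒲) (h𝒳 : IsSyzygyClosed 𝒲 𝒳) :
    Orthogonal.{w} 𝒲 𝒳 := by
  refine orthogonal_iff.2 fun V X mem_V mem_X n ↦ ?_
  induction n generalizing X with
  | zero =>
    obtain ⟨_, K, _, _, _, -, hS⟩ := h𝒳.right X mem_X
    exact subsingleton_ext_one_X₁ hS.shortExact (hS.lifts V mem_V) (hO _ _ mem_V hS.mem 1 le_rfl)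
  | succ n ih =>
    obtain ⟨_, K, _, _, _, mem_K, hS⟩ := h𝒳.right X mem_X
    exact subsingleton_ext_X₁ hS.shortExact (ih K mem_K) (hO _ _ mem_V hS.mem _ (by lia))

lemma isProperSyzygy (h𝒳 : Orthogonal.{w} 𝒲 𝒳) {S : ShortComplex A} (hS : S.ShortExact)
    (h₁ : 𝒳 S.X₁) (h₂ : 𝒲 S.X₂) : IsProperSyzygy 𝒲 S where
  shortExact := hS
  mem := h₂
  lifts V hV := exists_lift_of_ext_one hS (h𝒳 V _ hV h₁ 1 le_rfl)

lemma isTotalSyzygy (h𝒳 : Orthogonal.{w} 𝒲 𝒳) (h𝒳' : Orthogonal.{w} 𝒳 𝒲) {S : ShortComplex A}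
    (hS : S.ShortExact) (h₁ : 𝒳 S.X₁) (h₂ : 𝒲 S.X₂) (h₃ : 𝒳 S.X₃) : IsTotalSyzygy 𝒲 S where
  __ := h𝒳.isProperSyzygy hS h₁ h₂
  ext V hV := exists_extension_of_ext_one hS (h𝒳' _ V h₃ hV 1 le_rfl)

end Orthogonal

end Orthogonality

section ExtensionClosure

variable {A : Type u} [Category.{v} A] [Abelian A] [HasExt.{w} A] {𝒲 𝒳 : ObjectProperty A}
  [𝒲.IsClosedUnderBinaryProducts] (hO : Orthogonal.{w} 𝒲 𝒲)

include hO

theorem IsSyzygyClosed.extensions (h𝒳 : IsSyzygyClosed 𝒲 𝒳) :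
    IsSyzygyClosed 𝒲 (extensions 𝒳 𝒳) := by
  have hr := hO.isSyzygyClosed_right h𝒳
  have hl := hO.isSyzygyClosed_left h𝒳
  constructor
  · rintro Y ⟨X, Z, f, g, w, hX, hZ, hS⟩
    obtain ⟨K₁, V₁, _, _, _, hK₁, h₁⟩ := h𝒳.left X hX
    obtain ⟨K₃, V₃, _, p₃, _, hK₃, h₃⟩ := h𝒳.left Z hZ
    obtain ⟨l, hl₃⟩ := exists_lift_of_ext_one hS (hr _ _ h₃.mem hX 1 le_rfl) p₃
    obtain ⟨K, i, p, w, hE, f', g', w', hK⟩ :=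
      exists_horseshoe hS h₁.shortExact h₃.shortExact l hl₃
    have mem_K : RelTate.extensions 𝒳 𝒳 K := ⟨K₁, K₃, f', g', w', hK₁, hK₃, hK⟩
    exact ⟨K, _, i, p, w, mem_K, (hr.extensions_right hr).isTotalSyzygy (hl.extensions_left hl)
      hE mem_K (prop_biprod h₁.mem h₃.mem) ⟨X, Z, f, g, _, hX, hZ, hS⟩⟩
  · rintro Y ⟨X, Z, f, g, w, hX, hZ, hS⟩
    obtain ⟨V₁, K₁, i₁, _, _, hK₁, h₁⟩ := h𝒳.right X hX
    obtain ⟨V₃, K₃, _, _, _, hK₃, h₃⟩ := h𝒳.right Z hZ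
    obtain ⟨l, hl₁⟩ := exists_extension_of_ext_one hS (hl _ _ hZ h₁.mem 1 le_rfl) i₁
    obtain ⟨K, i, p, w, hE, f', g', w', hK⟩ :=
      exists_cohorseshoe hS h₁.shortExact h₃.shortExact l hl₁
    have mem_K : RelTate.extensions 𝒳 𝒳 K := ⟨K₁, K₃, f', g', w', hK₁, hK₃, hK⟩
    exact ⟨_, K, i, p, w, mem_K, (hr.extensions_right hr).isTotalSyzygy (hl.extensions_left hl)
      hE ⟨X, Z, f, g, _, hX, hZ, hS⟩ (prop_biprod h₁.mem h₃.mem) mem_K⟩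

theorem gorenstein_isClosedUnderExtensions : (gorenstein 𝒲).IsClosedUnderExtensions where
  prop_X₂_of_shortExact {S} hS h₁ h₃ :=
    (isSyzygyClosed_gorenstein.extensions hO).le_gorenstein _
      ⟨S.X₁, S.X₃, S.f, S.g, S.zero, h₁, h₃, hS⟩

lemma nthSyzygyIn_gorenstein_X₂ {n : ℕ} {S : ShortComplex A} (hS : S.ShortExact)
    (h₁ : gorenstein 𝒲 S.X₁) (h₃ : nthSyzygyIn 𝒲 (gorenstein 𝒲) n S.X₃) :
    nthSyzygyIn 𝒲 (gorenstein 𝒲) n S.X₂ := by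
  induction n generalizing S with
  | zero =>
    have := gorenstein_isClosedUnderExtensions hO
    exact (gorenstein 𝒲).prop_X₂_of_shortExact hS h₁ h₃
  | succ n ih =>
    have hr := hO.isSyzygyClosed_right isSyzygyClosed_gorenstein
    obtain ⟨K₁, V₁, _, _, _, hK₁, hS₁⟩ := isSyzygyClosed_gorenstein.left _ h₁
    obtain ⟨K₃, V₃, _, p₃, _, hK₃, hV₃, hS₃⟩ := h₃
    obtain ⟨l, hl⟩ := exists_lift_of_ext_one hS (hr _ _ hV₃ h₁ 1 le_rfl) p₃
    obtain ⟨K, i, p, w, hE, _, _, _, hK⟩ := exists_horseshoe hS hS₁.shortExact hS₃ l hl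
    exact ⟨K, _, i, p, w, ih hK hK₁ hK₃, prop_biprod hS₁.mem hV₃, hE⟩

theorem nthSyzygyIn_of_nthSyzygyIn_gorenstein {n : ℕ} {M : A}
    (h : nthSyzygyIn (gorenstein 𝒲) (gorenstein 𝒲) n M) : nthSyzygyIn 𝒲 (gorenstein 𝒲) n M := by
  induction n generalizing M with
  | zero => exact h
  | succ n ih =>
    obtain ⟨L, G, j, q, _, hL, hG, hS⟩ := h
    obtain ⟨K, V, i, p, _, hK, hT⟩ := isSyzygyClosed_gorenstein.left G hG
    obtain ⟨N, k, w, hN, _, _, _, hKNL⟩ := exists_kernel_comp hT.shortExact hS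
    exact ⟨N, V, k, p ≫ q, w, nthSyzygyIn_gorenstein_X₂ hO hKNL hK (ih hL), hT.mem, hN⟩

end ExtensionClosure

section Resolutions

variable {A : Type u} [Category.{v} A] [Abelian A] {𝒲 𝒳 : ObjectProperty A}

lemma chainComplex_acyclic_iff (K : ChainComplex A ℕ) :
    K.Acyclic ↔ Epi (K.d 1 0) ∧
      ∀ n, (ShortComplex.mk (K.d (n + 2) (n + 1)) (K.d (n + 1) n) (by simp)).Exact := by
  have exactAt_zero : K.ExactAt 0 ↔ Epi (K.d 1 0) := by
    rw [HomologicalComplex.exactAt_iff' _ 1 0 0 (by simp) (by simp)]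
    exact ShortComplex.exact_iff_epi _ (K.shape _ _ (by simp))
  have exactAt_succ (n : ℕ) : K.ExactAt (n + 1) ↔
      (ShortComplex.mk (K.d (n + 2) (n + 1)) (K.d (n + 1) n) (by simp)).Exact :=
    HomologicalComplex.exactAt_iff' _ (n + 2) (n + 1) n (by simp) (by simp)
  rw [← exactAt_zero]
  simp only [← exactAt_succ]
  exact ⟨fun h ↦ ⟨h 0, fun n ↦ h (n + 1)⟩, fun h n ↦ Nat.casesOn n h.1 h.2⟩

lemma chainComplex_homFromExact_iff (K : ChainComplex A ℕ) :
    HomFromExact 𝒳 K ↔ ∀ V : A, 𝒳 V → (∀ f : V ⟶ K.X 0, ∃ g : V ⟶ K.X 1, g ≫ K.d 1 0 = f) ∧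
      ∀ n, ∀ f : V ⟶ K.X (n + 1), f ≫ K.d (n + 1) n = 0 →
        ∃ g : V ⟶ K.X (n + 2), g ≫ K.d (n + 2) (n + 1) = f := by
  have exactAt_zero (V : A) := mapPreadditiveCoyoneda_exactAt_iff K V (i := 1) (j := 0) (k := 0)
    (by simp) (by simp)
  have exactAt_succ (V : A) (n : ℕ) := mapPreadditiveCoyoneda_exactAt_iff K V
    (i := n + 2) (j := n + 1) (k := n) (by simp) (by simp)
  have d_zero : K.d 0 0 = 0 := K.shape _ _ (by simp)
  simp only [d_zero, comp_zero, true_imp_iff] at exactAt_zero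
  simp only [← exactAt_zero, ← exactAt_succ]
  exact ⟨fun h V hV ↦ ⟨h V hV 0, fun n ↦ h V hV (n + 1)⟩,
    fun h V hV n ↦ Nat.casesOn n (h V hV).1 (h V hV).2⟩

namespace Resolution

section Splice

variable {S : ShortComplex A}

/-- The resolution of `S.X₃` obtained from a short exact sequence `S` and a resolution of `S.X₁`. -/
noncomputable def splice (X : Resolution 𝒳 S.X₁) (hS : S.ShortExact) (h₂ : 𝒳 S.X₂) :
    Resolution 𝒳 S.X₃ where
  complex := X.complex.augment (X.ε ≫ S.f) (by rw [reassoc_of% X.d_comp_ε, zero_comp])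
  mem
    | 0 => h₂
    | n + 1 => X.mem n
  ε := S.g
  d_comp_ε := show (X.ε ≫ S.f) ≫ S.g = 0 by rw [Category.assoc, S.zero, comp_zero]
  exact := by
    have := hS.mono_f
    obtain ⟨epi_ε : Epi X.ε, exact_X⟩ := (chainComplex_acyclic_iff _).1 X.exact
    refine (chainComplex_acyclic_iff _).2 ⟨hS.epi_g, ?_⟩
    rintro (_ | _ | n)
    · exact (exact_epi_comp_iff S X.ε).2 hS.exact
    · exact (exact_comp_mono_iff (.mk (X.complex.d 1 0) X.ε X.d_comp_ε) S.f).2 (exact_X 0)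
    · exact exact_X (n + 1)

lemma splice_isProper {X : Resolution 𝒳 S.X₁} (hX : X.IsProper) (hS : IsProperSyzygy 𝒳 S) :
    (X.splice hS.shortExact hS.mem).IsProper := by
  have := hS.shortExact.mono_f
  refine (chainComplex_homFromExact_iff _).2 fun V hV ↦ ⟨hS.lifts V hV, ?_⟩
  obtain ⟨lift_ε, lift_d⟩ := (chainComplex_homFromExact_iff _).1 hX V hV
  rintro (_ | _ | n)
  · intro (f : V ⟶ S.X₂) (hf : f ≫ S.g = 0)
    obtain ⟨x, hx⟩ := hS.shortExact.exact.lift' f hf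
    obtain ⟨y, hy⟩ : ∃ y : V ⟶ X.complex.X 0, y ≫ X.ε = x := lift_ε x
    exact ⟨y, show y ≫ X.ε ≫ S.f = f by rw [reassoc_of% hy, hx]⟩
  · intro (f : V ⟶ X.complex.X 0) (hf : f ≫ X.ε ≫ S.f = 0)
    exact lift_d 0 f (show f ≫ X.ε = 0 by rw [← cancel_mono S.f, Category.assoc, hf, zero_comp])
  · exact lift_d (n + 1)

end Splice

section Syzygies

variable {M : A} (X : Resolution 𝒳 M) (n : ℕ)

/-- The `n`-th syzygy of a resolution, encoded as the cokernel of the differential arriving in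
degree `n`; the zeroth one is the resolved object. -/
noncomputable abbrev syzygy : A := X.augmented.opcycles (n + 1)

/-- The projection of the `n`-th term of a resolution to the `n`-th syzygy. -/
noncomputable def proj : X.complex.X n ⟶ X.syzygy n :=
  X.augmented.pOpcycles (n + 1)

/-- The inclusion of the `n + 1`-st syzygy in the `n`-th term of a resolution. -/
noncomputable def incl : X.syzygy (n + 1) ⟶ X.complex.X n :=
  X.augmented.fromOpcycles (n + 2) (n + 1)

instance : Epi (X.proj n) := inferInstanceAs (Epi (X.augmented.pOpcycles (n + 1)))

lemma d_proj : X.complex.d (n + 1) n ≫ X.proj n = 0 :=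
  X.augmented.d_pOpcycles (n + 2) (n + 1)

lemma proj_incl : X.proj (n + 1) ≫ X.incl n = X.complex.d (n + 1) n :=
  X.augmented.p_fromOpcycles (n + 2) (n + 1)

lemma incl_proj : X.incl n ≫ X.proj n = 0 :=
  (RelTate.syzygySequence X.augmented (n + 2) (n + 1)).zero

lemma exists_proj_desc {B : A} (k : X.complex.X n ⟶ B) (hk : X.complex.d (n + 1) n ≫ k = 0) :
    ∃ θ : X.syzygy n ⟶ B, X.proj n ≫ θ = k :=
  ⟨X.augmented.descOpcycles (i := n + 1) k (n + 2) (by simp) hk,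
    X.augmented.p_descOpcycles (i := n + 1) k (n + 2) (by simp) hk⟩

/-- The short complex that exhibits the `n + 1`-st syzygy of a resolution as a syzygy of the
`n`-th one. -/
noncomputable abbrev syzygySequence : ShortComplex A :=
  ShortComplex.mk (X.incl n) (X.proj n) (X.incl_proj n)

lemma syzygySequence_shortExact : (X.syzygySequence n).ShortExact :=
  RelTate.syzygySequence_shortExact X.augmented (i := n + 2) (j := n + 1) (by simp) (X.exact _)

/-- The isomorphism from the zeroth syzygy induced by the augmentation. -/
noncomputable def syzygyZeroIso : X.syzygy 0 ≅ M :=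
  have h_mono : Mono (X.augmented.fromOpcycles 1 0) :=
    mono_fromOpcycles X.augmented (by simp) (X.exact 1)
  have h_epi : Epi (X.augmented.pOpcycles 1 ≫ X.augmented.fromOpcycles 1 0) := by
    rw [HomologicalComplex.p_fromOpcycles]
    exact ((chainComplex_acyclic_iff _).1 X.exact).1
  have h_epi' := epi_of_epi (X.augmented.pOpcycles 1) (X.augmented.fromOpcycles 1 0)
  @asIso _ _ _ _ (X.augmented.fromOpcycles 1 0)
    (isIso_of_mono_of_epi (X.augmented.fromOpcycles 1 0))

variable {X} in
lemma IsProper.isProperSyzygy (hX : X.IsProper) : IsProperSyzygy 𝒳 (X.syzygySequence n) where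
  shortExact := X.syzygySequence_shortExact n
  mem := X.mem n
  lifts V hV (f : V ⟶ X.augmented.opcycles (n + 1)) := by
    have := mono_fromOpcycles X.augmented (i := n + 1) (j := n) (by simp) (X.exact (n + 1))
    obtain ⟨g, hg⟩ := (homFromExact_iff 𝒳 X.augmented).1 hX V hV (n + 1) n _ (by simp) rfl
      (f ≫ X.augmented.fromOpcycles (n + 1) n) (by simp)
    refine ⟨g, show g ≫ X.augmented.pOpcycles (n + 1) = f from ?_⟩
    rw [← cancel_mono (X.augmented.fromOpcycles (n + 1) n), ← hg, Category.assoc,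
      HomologicalComplex.p_fromOpcycles]

lemma nthSyzygyIn_of_syzygy [𝒳.IsClosedUnderIsomorphisms] (h : 𝒳 (X.syzygy n)) :
    nthSyzygyIn 𝒳 𝒳 n M := by
  have nthSyzygyIn_syzygy (k m : ℕ) (hm : m + k = n) : nthSyzygyIn 𝒳 𝒳 k (X.syzygy m) := by
    induction k generalizing m with
    | zero =>
      obtain rfl : m = n := hm
      exact h
    | succ k ih =>
      exact ⟨_, _, _, _, _, ih (m + 1) (by lia), X.mem m, X.syzygySequence_shortExact m⟩
  exact (nthSyzygyIn 𝒳 𝒳 n).prop_of_iso X.syzygyZeroIso (nthSyzygyIn_syzygy n 0 (zero_add n))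

end Syzygies

lemma length_lt_top_iff {M : A} (X : Resolution 𝒳 M) :
    X.length < ⊤ ↔ ∃ N : ℕ, ∀ n, N ≤ n → IsZero (X.complex.X n) := by
  constructor
  · intro h
    obtain ⟨N, hN⟩ := ENat.ne_top_iff_exists.1 h.ne
    refine ⟨N + 1, fun n hn ↦ ?_⟩
    by_contra h_nonzero
    have le_length : (n : ℕ∞) ≤ X.length :=
      le_iSup₂ (f := fun (n : ℕ) (_ : ¬ IsZero (X.complex.X n)) ↦ (n : ℕ∞)) n h_nonzero
    rw [← hN, Nat.cast_le] at le_length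
    lia
  · rintro ⟨N, hN⟩
    refine lt_of_le_of_lt (iSup₂_le (a := (N : ℕ∞)) fun n hn ↦ ?_) (ENat.natCast_lt_top N)
    rw [Nat.cast_le]
    by_contra h_lt
    exact hn (hN n (by lia))

end Resolution

lemma projDim_lt_top_iff {M : A} : projDim 𝒳 M < ⊤ ↔
    ∃ (X : Resolution 𝒳 M) (N : ℕ), ∀ n, N ≤ n → IsZero (X.complex.X n) := by
  simp only [projDim, iInf_lt_iff, Resolution.length_lt_top_iff]

lemma projDim_X₃_lt_top {S : ShortComplex A} (hS : S.ShortExact) (h₂ : 𝒳 S.X₂)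
    (h₁ : projDim 𝒳 S.X₁ < ⊤) : projDim 𝒳 S.X₃ < ⊤ := by
  obtain ⟨X, N, hN⟩ := projDim_lt_top_iff.1 h₁
  refine projDim_lt_top_iff.2 ⟨X.splice hS h₂, N + 1, ?_⟩
  rintro (_ | n) hn
  · lia
  · exact hN n (by lia)

lemma exists_nthSyzygyIn_of_projDim_lt_top [𝒳.IsClosedUnderIsomorphisms] {M : A}
    (hM : projDim 𝒳 M < ⊤) : ∃ n, nthSyzygyIn 𝒳 𝒳 n M := by
  obtain ⟨X, N, hN⟩ := projDim_lt_top_iff.1 hM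
  have isZero_X : IsZero (X.complex.X N) := hN N le_rfl
  have isZero_syzygy : IsZero (X.syzygy N) := IsZero.of_epi (X.proj N) isZero_X
  exact ⟨N, X.nthSyzygyIn_of_syzygy N (𝒳.prop_of_iso (isZero_X.iso isZero_syzygy) (X.mem N))⟩

section ContainsZero

variable [𝒳.ContainsZero] [𝒳.IsClosedUnderIsomorphisms]

open scoped ZeroObject

lemma projDim_lt_top_of_isZero {Z : A} (hZ : IsZero Z) : projDim 𝒳 Z < ⊤ := by
  let X : Resolution 𝒳 Z :=
    { complex := .of (fun _ ↦ 0) (fun _ ↦ 0) (fun _ ↦ comp_zero)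
      mem _ := 𝒳.prop_of_isZero (isZero_zero A)
      ε := 0
      d_comp_ε := comp_zero
      exact n := HomologicalComplex.ExactAt.of_isZero (Nat.casesOn n hZ fun _ ↦ isZero_zero A) }
  exact projDim_lt_top_iff.2 ⟨X, 0, fun _ _ ↦ isZero_zero A⟩

lemma projDim_lt_top_of_prop {M : A} (hM : 𝒳 M) : projDim 𝒳 M < ⊤ := by
  have hS : (ShortComplex.mk (0 : 0 ⟶ M) (𝟙 M) zero_comp).ShortExact :=
    .mk' ((ShortComplex.exact_iff_mono _ rfl).2 inferInstance) inferInstance inferInstance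
  exact projDim_X₃_lt_top hS hM (projDim_lt_top_of_isZero (isZero_zero A))

lemma projDim_lt_top_of_nthSyzygyIn {M : A} {n : ℕ} (hM : nthSyzygyIn 𝒳 𝒳 n M) :
    projDim 𝒳 M < ⊤ := by
  induction n generalizing M with
  | zero => exact projDim_lt_top_of_prop hM
  | succ n ih =>
    obtain ⟨K, V, i, p, w, hK, hV, hS⟩ := hM
    exact projDim_X₃_lt_top hS hV (ih hK)

end ContainsZero

end Resolutions

section Existence

variable {A : Type u} [Category.{v} A] [Abelian A] {𝒲 : ObjectProperty A}

/-- The part of a complex in nonnegative degrees, with the other terms removed. -/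
def truncation (T : ChainComplex A ℤ) : ChainComplex A ℕ where
  X n := T.X (n : ℤ)
  d i j := T.d (i : ℤ) (j : ℤ)
  shape i j hij := T.shape _ _ fun h : (j : ℤ) + 1 = i ↦ hij (by exact_mod_cast h)
  d_comp_d' _ _ _ _ _ := T.d_comp_d _ _ _

section Truncation

variable {T : ChainComplex A ℤ} (hT : IsTotallyAcyclic 𝒲 T) {M : A}
  (e : T.opcycles ((0 : ℕ) : ℤ) ≅ M)

/-- The resolution of the zeroth syzygy of a totally acyclic complex by its nonnegative part. -/
noncomputable def truncationResolution : Resolution 𝒲 M where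
  complex := truncation T
  mem n := hT.mem n
  ε := T.pOpcycles ((0 : ℕ) : ℤ) ≫ e.hom
  d_comp_ε := (T.d_pOpcycles_assoc ((1 : ℕ) : ℤ) _ e.hom).trans zero_comp
  exact := by
    refine (chainComplex_acyclic_iff _).2
      ⟨inferInstanceAs (Epi (T.pOpcycles ((0 : ℕ) : ℤ) ≫ e.hom)), ?_⟩
    rintro (_ | n)
    · have exact_p : (ShortComplex.mk (T.d ((1 : ℕ) : ℤ) ((0 : ℕ) : ℤ)) (T.pOpcycles _)
          (T.d_pOpcycles _ _)).Exact :=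
        ShortComplex.exact_of_g_is_cokernel _ (T.opcyclesIsCokernel _ _ (by simp))
      exact (exact_comp_mono_iff _ e.hom).2 exact_p
    · exact (HomologicalComplex.exactAt_iff' T ((n + 2 : ℕ) : ℤ) ((n + 1 : ℕ) : ℤ) (n : ℤ)
        (by simp; lia) (by simp)).1 (hT.exact _)

lemma truncationResolution_isProper : (truncationResolution hT e).IsProper := by
  have homFrom_T := (homFromExact_iff 𝒲 T).1 hT.homFrom
  refine (chainComplex_homFromExact_iff _).2 fun V hV ↦ ⟨fun (f : V ⟶ M) ↦ ?_, ?_⟩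
  · obtain ⟨g, hg⟩ := (hT.isTotalSyzygy (i := 1) (j := ((0 : ℕ) : ℤ)) (by simp)).lifts V hV
      (f ≫ e.inv)
    change g ≫ T.pOpcycles ((0 : ℕ) : ℤ) = f ≫ e.inv at hg
    refine ⟨g, show g ≫ T.pOpcycles ((0 : ℕ) : ℤ) ≫ e.hom = f from ?_⟩
    rw [reassoc_of% hg, e.inv_hom_id, Category.comp_id]
  rintro (_ | n)
  · intro (f : V ⟶ T.X ((0 : ℕ) : ℤ)) (hf : f ≫ T.pOpcycles ((0 : ℕ) : ℤ) ≫ e.hom = 0)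
    have hf' : f ≫ T.pOpcycles ((0 : ℕ) : ℤ) = 0 := by
      rw [← cancel_mono e.hom, Category.assoc, hf, zero_comp]
    refine homFrom_T V hV ((1 : ℕ) : ℤ) ((0 : ℕ) : ℤ) _ (by simp) rfl f ?_
    rw [← T.p_fromOpcycles, reassoc_of% hf', zero_comp]
  · exact homFrom_T V hV ((n + 2 : ℕ) : ℤ) ((n + 1 : ℕ) : ℤ) (n : ℤ) (by simp; lia) (by simp)

end Truncation

lemma hasTateResolution_of_gorenstein {M : A} (hM : gorenstein 𝒲 M) : HasTateResolution 𝒲 M := by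
  obtain ⟨T, hT, ⟨e⟩⟩ := exists_iso_opcycles_zero hM
  exact ⟨⟨{
    T := T
    totallyAcyclic := hT
    W := truncationResolution hT e.symm
    proper := truncationResolution_isProper hT e.symm
    α _ := 𝟙 _
    comm _ := (Category.id_comp _).trans (Category.comp_id _).symm
    eventually_isIso := ⟨0, fun _ _ ↦ inferInstanceAs (IsIso (𝟙 _))⟩ }⟩⟩

section Splice

variable {S : ShortComplex A}

lemma TateResolution.exists_comm_splice (τ : TateResolution 𝒲 S.X₁) (h₂ : 𝒲 S.X₂) :
    ∃ g : τ.T.X (-1) ⟶ S.X₂, τ.T.d 0 (-1) ≫ g = τ.α 0 ≫ τ.W.ε ≫ S.f := by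
  refine (homIntoExact_iff 𝒲 τ.T).1 τ.totallyAcyclic.homInto S.X₂ h₂ 1 0 (-1) (by simp) (by simp)
    (τ.α 0 ≫ τ.W.ε ≫ S.f) ?_
  have comm_zero : τ.α 1 ≫ τ.W.complex.d 1 0 = τ.T.d 1 0 ≫ τ.α 0 := τ.comm 0
  have d_comp_ε := τ.W.d_comp_ε
  rw [← reassoc_of% comm_zero, reassoc_of% d_comp_ε, zero_comp, comp_zero]

/-- The Tate resolution of `S.X₃` obtained by splicing one of `S.X₁` with `S`; its
totally acyclic complex is the given one with degrees raised by one. -/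
noncomputable def TateResolution.splice (τ : TateResolution 𝒲 S.X₁) (hS : IsProperSyzygy 𝒲 S)
    (g : τ.T.X (-1) ⟶ S.X₂) (hg : τ.T.d 0 (-1) ≫ g = τ.α 0 ≫ τ.W.ε ≫ S.f) :
    TateResolution 𝒲 S.X₃ :=
  have succ_add_neg_one (n : ℕ) : ((n + 1 : ℕ) : ℤ) + -1 = n := by simp
  { T := reindex τ.T (-1)
    totallyAcyclic := τ.totallyAcyclic.reindex (-1)
    W := τ.W.splice hS.shortExact hS.mem
    proper := Resolution.splice_isProper τ.proper hS
    α
      | 0 => g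
      | n + 1 => (τ.T.XIsoOfEq (succ_add_neg_one n)).hom ≫ τ.α n
    comm
      | 0 => show (𝟙 (τ.T.X 0) ≫ τ.α 0) ≫ τ.W.ε ≫ S.f = τ.T.d 0 (-1) ≫ g by
        rw [Category.id_comp, hg]
      | n + 1 => by
        change ((τ.T.XIsoOfEq _).hom ≫ τ.α (n + 1)) ≫ τ.W.complex.d (n + 1) n =
          τ.T.d (((n + 1 + 1 : ℕ) : ℤ) + -1) (((n + 1 : ℕ) : ℤ) + -1) ≫
            (τ.T.XIsoOfEq (succ_add_neg_one n)).hom ≫ τ.α n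
        rw [Category.assoc, τ.comm, HomologicalComplex.d_comp_XIsoOfEq_hom_assoc,
          HomologicalComplex.XIsoOfEq_hom_comp_d_assoc]
    eventually_isIso := by
      obtain ⟨N, hN⟩ := τ.eventually_isIso
      refine ⟨N + 1, ?_⟩
      rintro (_ | n) hn
      · lia
      · have := hN n (by lia)
        exact inferInstanceAs (IsIso ((τ.T.XIsoOfEq (succ_add_neg_one n)).hom ≫ τ.α n)) }

lemma hasTateResolution_X₃ (hS : IsProperSyzygy 𝒲 S) (h₁ : HasTateResolution 𝒲 S.X₁) :
    HasTateResolution 𝒲 S.X₃ := by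
  obtain ⟨τ⟩ := h₁.nonempty
  obtain ⟨g, hg⟩ := τ.exists_comm_splice hS.mem
  exact ⟨⟨τ.splice hS g hg⟩⟩

end Splice

theorem hasTateResolution_of_projDim_gorenstein_lt_top [HasExt.{w} A]
    [𝒲.IsClosedUnderBinaryProducts] (hO : Orthogonal.{w} 𝒲 𝒲) {M : A}
    (hM : projDim (gorenstein 𝒲) M < ⊤) : HasTateResolution 𝒲 M := by
  obtain ⟨n, h⟩ := exists_nthSyzygyIn_of_projDim_lt_top hM
  replace h := nthSyzygyIn_of_nthSyzygyIn_gorenstein hO h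
  clear hM
  induction n generalizing M with
  | zero => exact hasTateResolution_of_gorenstein h
  | succ n ih =>
    obtain ⟨K, V, i, p, w, hK, hV, hS⟩ := h
    have hO_syzygies :=
      hO.nthSyzygyIn_right (hO.isSyzygyClosed_right isSyzygyClosed_gorenstein) n
    exact hasTateResolution_X₃ (hO_syzygies.isProperSyzygy hS hK hV) (ih hK)

end Existence

section Tate

variable {A : Type u} [Category.{v} A] [Abelian A] {𝒲 : ObjectProperty A}

namespace IsTotallyAcyclic

variable {T T' : ChainComplex A ℤ}

lemma isZero_homology_homComplex_iff (hT : IsTotallyAcyclic 𝒲 T) (n : ℤ) (N : A) :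
    IsZero ((homComplex T N).homology n) ↔ ∀ f : T.opcycles n ⟶ N, FactorsThrough 𝒲 f := by
  rw [← HomologicalComplex.exactAt_iff_isZero_homology,
    homComplex_exactAt_iff T N (i := n + 1) (j := n) (k := n - 1) (by simp) (by simp)]
  constructor
  · intro h f
    obtain ⟨g, hg⟩ := h (T.pOpcycles n ≫ f) (by simp)
    refine ⟨_, hT.mem (n - 1), T.fromOpcycles n (n - 1), g, ?_⟩
    rw [← cancel_epi (T.pOpcycles n), ← hg, T.p_fromOpcycles_assoc]
  · intro h f hf
    obtain ⟨V, hV, a, b, hab⟩ := h (T.descOpcycles f (n + 1) (by simp) hf)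
    obtain ⟨a', ha'⟩ : ∃ a' : T.X (n - 1) ⟶ V, T.fromOpcycles n (n - 1) ≫ a' = a :=
      (hT.isTotalSyzygy (sub_add_cancel n 1)).ext V hV a
    refine ⟨a' ≫ b, ?_⟩
    rw [← T.p_fromOpcycles, Category.assoc, reassoc_of% ha', hab, T.p_descOpcycles]

lemma prop_opcycles [𝒲.IsStableUnderRetracts] (hT : IsTotallyAcyclic 𝒲 T) {a : ℤ}
    (ha : 𝒲 (T.opcycles a)) (b : ℤ) : 𝒲 (T.opcycles b) :=
  Int.inductionOn' b a ha (fun _ _ h ↦ (hT.isTotalSyzygy rfl).prop_τ₁ h)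
    fun n _ h ↦ (hT.isTotalSyzygy (sub_add_cancel n 1)).prop_τ₃ h

lemma stableRetract_opcycles (hT : IsTotallyAcyclic 𝒲 T) (hT' : IsTotallyAcyclic 𝒲 T') {a b : ℤ}
    (h : StableRetract 𝒲 (T.opcycles a) (T'.opcycles b)) (k : ℤ) :
    StableRetract 𝒲 (T.opcycles (a + k)) (T'.opcycles (b + k)) := by
  refine Int.inductionOn' k 0 (by simpa using h) (fun n _ ih ↦ ?_) fun n _ ih ↦ ?_
  · exact .τ₁ (hT.isTotalSyzygy (add_assoc a n 1)).toIsProperSyzygy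
      (hT'.isTotalSyzygy (add_assoc b n 1)).toIsProperSyzygy ih
  · exact .τ₃ (hT.isTotalSyzygy (by lia)) (hT'.isTotalSyzygy (by lia)) ih

end IsTotallyAcyclic

lemma isZero_tateExt_iff (n : ℤ) (M N : A) [HasTateResolution 𝒲 M] :
    IsZero (tateExt 𝒲 n M N) ↔
      ∀ f : (tateResolution 𝒲 M).T.opcycles n ⟶ N, FactorsThrough 𝒲 f :=
  (tateResolution 𝒲 M).totallyAcyclic.isZero_homology_homComplex_iff n N

namespace TateResolution

section

variable {M : A} (τ : TateResolution 𝒲 M)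

/-- The morphism on `n`-th syzygies induced by the comparison morphism. -/
noncomputable def syzygyMap (n : ℕ) : τ.T.opcycles (n : ℤ) ⟶ τ.W.syzygy n :=
  τ.T.descOpcycles (τ.α n ≫ τ.W.proj n) ((n + 1 : ℕ) : ℤ) (by simp)
    (by rw [← reassoc_of% (τ.comm n), τ.W.d_proj, comp_zero])

lemma p_syzygyMap (n : ℕ) : τ.T.pOpcycles (n : ℤ) ≫ τ.syzygyMap n = τ.α n ≫ τ.W.proj n :=
  τ.T.p_descOpcycles ..

/-- The morphism of syzygy sequences induced by the comparison morphism. -/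
noncomputable def syzygySequenceMap (n : ℕ) :
    syzygySequence τ.T ((n + 1 : ℕ) : ℤ) (n : ℤ) ⟶ τ.W.syzygySequence n where
  τ₁ := τ.syzygyMap (n + 1)
  τ₂ := τ.α n
  τ₃ := τ.syzygyMap n
  comm₁₂ := by
    change τ.syzygyMap (n + 1) ≫ τ.W.incl n = τ.T.fromOpcycles _ _ ≫ τ.α n
    rw [← cancel_epi (τ.T.pOpcycles ((n + 1 : ℕ) : ℤ)), reassoc_of% (τ.p_syzygyMap (n + 1)),
      τ.W.proj_incl, τ.T.p_fromOpcycles_assoc, τ.comm]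
  comm₂₃ := (τ.p_syzygyMap n).symm

lemma isIso_syzygyMap {n : ℕ} (h₀ : IsIso (τ.α n)) (h₁ : IsIso (τ.α (n + 1))) :
    IsIso (τ.syzygyMap n) := by
  have d_inv_α : τ.W.complex.d (n + 1) n ≫ inv (τ.α n) ≫ τ.T.pOpcycles (n : ℤ) = 0 := by
    rw [← cancel_epi (τ.α (n + 1)), reassoc_of% (τ.comm n), IsIso.hom_inv_id_assoc,
      τ.T.d_pOpcycles, comp_zero]
  obtain ⟨θ, hθ⟩ := τ.W.exists_proj_desc n _ d_inv_α
  refine ⟨θ, ?_, ?_⟩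
  · rw [← cancel_epi (τ.T.pOpcycles (n : ℤ)), reassoc_of% (τ.p_syzygyMap n), hθ,
      IsIso.hom_inv_id_assoc, Category.comp_id]
  · rw [← cancel_epi (τ.W.proj n), reassoc_of% hθ, p_syzygyMap, IsIso.inv_hom_id_assoc,
      Category.comp_id]

lemma exists_isIso_syzygyMap : ∃ n : ℕ, IsIso (τ.syzygyMap n) := by
  obtain ⟨N, hN⟩ := τ.eventually_isIso
  exact ⟨N, τ.isIso_syzygyMap (hN N le_rfl) (hN (N + 1) N.le_succ)⟩

lemma factorsThrough_syzygyMap (h : FactorsThrough 𝒲 (τ.syzygyMap 0)) (n : ℕ) :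
    FactorsThrough 𝒲 (τ.syzygyMap n) := by
  induction n with
  | zero => exact h
  | succ n ih =>
    exact (τ.proper.isProperSyzygy n).factorsThrough_τ₁ (τ.totallyAcyclic.mem n)
      (τ.syzygySequenceMap n) ih

lemma prop_opcycles_of_factorsThrough [𝒲.IsStableUnderRetracts]
    (h : ∀ f : τ.T.opcycles 0 ⟶ M, FactorsThrough 𝒲 f) (n : ℤ) : 𝒲 (τ.T.opcycles n) := by
  have h_zero : FactorsThrough 𝒲 (τ.syzygyMap 0) := by
    have h' := (h (τ.syzygyMap 0 ≫ τ.W.syzygyZeroIso.hom)).comp_right τ.W.syzygyZeroIso.inv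
    rwa [Category.assoc, Iso.hom_inv_id, Category.comp_id] at h'
  obtain ⟨N, _⟩ := τ.exists_isIso_syzygyMap
  have h_id := (τ.factorsThrough_syzygyMap h_zero N).comp_right (inv (τ.syzygyMap N))
  rw [IsIso.hom_inv_id] at h_id
  exact τ.totallyAcyclic.prop_opcycles h_id.prop_of_id n

lemma projDim_lt_top [𝒲.ContainsZero] [𝒲.IsClosedUnderIsomorphisms]
    (h : ∀ n, 𝒲 (τ.T.opcycles n)) : projDim 𝒲 M < ⊤ := by
  obtain ⟨N, _⟩ := τ.exists_isIso_syzygyMap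
  have prop_syzygy : 𝒲 (τ.W.syzygy N) := 𝒲.prop_of_iso (asIso (τ.syzygyMap N)) (h N)
  exact projDim_lt_top_of_nthSyzygyIn (τ.W.nthSyzygyIn_of_syzygy N prop_syzygy)

end

/-- Both totally acyclic complexes are compared through the proper resolution of `τ`. -/
lemma stableRetract_opcycles [𝒲.ContainsZero] {T : ChainComplex A ℤ} (hT : IsTotallyAcyclic 𝒲 T)
    {a : ℤ} (τ : TateResolution 𝒲 (T.opcycles a)) (k : ℤ) :
    StableRetract 𝒲 (T.opcycles (a + k)) (τ.T.opcycles k) := by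
  have stableRetract_syzygy (m : ℕ) : StableRetract 𝒲 (T.opcycles (a + m)) (τ.W.syzygy m) := by
    induction m with
    | zero => simpa using StableRetract.of_iso (𝒲 := 𝒲) τ.W.syzygyZeroIso.symm
    | succ m ih =>
      have hT_m := hT.isTotalSyzygy (i := a + ((m + 1 : ℕ) : ℤ)) (j := a + m) (by push_cast; ring)
      exact .τ₁ hT_m.toIsProperSyzygy (τ.proper.isProperSyzygy m) ih
  obtain ⟨N, _⟩ := τ.exists_isIso_syzygyMap
  have h_N : StableRetract 𝒲 (T.opcycles (a + N)) (τ.T.opcycles N) :=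
    (stableRetract_syzygy N).congr (Iso.refl _) (asIso (τ.syzygyMap N)).symm
  have h_k := hT.stableRetract_opcycles τ.totallyAcyclic h_N (k - N)
  rwa [show a + N + (k - N) = a + k by ring, add_sub_cancel] at h_k

end TateResolution

lemma factorsThrough_of_nthSyzygyIn [HasExt.{w} A] (hO : Orthogonal.{w} 𝒲 𝒲) {X M : A}
    (hX : gorenstein 𝒲 X) {n : ℕ} (hM : nthSyzygyIn 𝒲 𝒲 n M) (f : X ⟶ M) :
    FactorsThrough 𝒲 f := by
  have hO_left := hO.isSyzygyClosed_left isSyzygyClosed_gorenstein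
  cases n with
  | zero =>
    have mem_M : 𝒲 M := hM
    simpa using (factorsThrough_id mem_M).comp_left f
  | succ n =>
    obtain ⟨K, V, i, p, w, hK, hV, hS⟩ := hM
    have h_ext := hO_left.nthSyzygyIn_right hO_left n X K hX hK 1 le_rfl
    obtain ⟨g, hg⟩ := exists_lift_of_ext_one hS h_ext f
    exact ⟨V, hV, g, p, hg⟩

theorem tateExt_tfae [HasExt.{w} A] [𝒲.ContainsZero] [𝒲.IsStableUnderRetracts]
    [𝒲.IsClosedUnderBinaryProducts] (hO : Orthogonal.{w} 𝒲 𝒲) (M : A) [HasTateResolution 𝒲 M] :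
    List.TFAE [
      projDim 𝒲 M < ⊤,
      ∀ (n : ℤ) (X : A) [HasTateResolution 𝒲 X], IsZero (tateExt 𝒲 n X M),
      ∃ n : ℤ, ∀ (X : A) [HasTateResolution 𝒲 X], IsZero (tateExt 𝒲 n X M),
      ∀ (n : ℤ) (N : A), IsZero (tateExt 𝒲 n M N),
      ∃ n : ℤ, ∀ N : A, IsZero (tateExt 𝒲 n M N),
      IsZero (tateExt 𝒲 0 M M)] := by
  let τ := tateResolution 𝒲 M
  tfae_have 1 → 2 := by
    intro h n X _
    obtain ⟨m, hm⟩ := exists_nthSyzygyIn_of_projDim_lt_top h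
    exact (isZero_tateExt_iff n X M).2 (factorsThrough_of_nthSyzygyIn hO
      ((tateResolution 𝒲 X).totallyAcyclic.gorenstein_opcycles n) hm)
  tfae_have 2 → 3 := fun h ↦ ⟨0, fun X _ ↦ h 0 X⟩
  -- The syzygy of degree `-n` of `τ.T` has an `n`-th syzygy stably isomorphic to the zeroth one.
  tfae_have 3 → 6 := by
    rintro ⟨n, h⟩
    have := hasTateResolution_of_gorenstein (τ.totallyAcyclic.gorenstein_opcycles (-n))
    have retract := TateResolution.stableRetract_opcycles τ.totallyAcyclic
      (tateResolution 𝒲 (τ.T.opcycles (-n))) n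
    rw [neg_add_cancel] at retract
    exact (isZero_tateExt_iff 0 M M).2
      (retract.factorsThrough ((isZero_tateExt_iff n (τ.T.opcycles (-n)) M).1 (h _)))
  tfae_have 6 → 4 := by
    intro h n N
    have prop_opcycles :=
      τ.prop_opcycles_of_factorsThrough ((isZero_tateExt_iff 0 M M).1 h) n
    refine (isZero_tateExt_iff n M N).2 fun f ↦ ?_
    simpa using (factorsThrough_id prop_opcycles).comp_right f
  tfae_have 4 → 5 := fun h ↦ ⟨0, h 0⟩
  tfae_have 5 → 1 := by
    rintro ⟨n, h⟩
    have prop_opcycles : 𝒲 (τ.T.opcycles n) :=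
      ((isZero_tateExt_iff n M (τ.T.opcycles n)).1 (h _) (𝟙 _)).prop_of_id
    exact τ.projDim_lt_top (τ.totallyAcyclic.prop_opcycles prop_opcycles)
  tfae_finish

end Tate

section LinearAlgebra

variable {R C P Q F M : Type*} [CommRing R] [AddCommGroup C] [Module R C] [AddCommGroup P]
  [Module R P] [AddCommGroup Q] [Module R Q] [AddCommGroup F] [Module R F] [AddCommGroup M]
  [Module R M]

lemma bijective_mk_finsupp (J : Type*) [Module.Finite R C]
    (h : Function.Bijective fun r : R ↦ r • (LinearMap.id : C →ₗ[R] C)) :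
    Function.Bijective (TensorProduct.mk R (J →₀ R) C) := by
  classical
  let E := TensorProduct.finsuppScalarLeft R C J
  let homothety : R →ₗ[R] C →ₗ[R] C := LinearMap.toSpanSingleton R _ LinearMap.id
  have h_coords (p : J →₀ R) : E.toLinearMap ∘ₗ TensorProduct.mk R (J →₀ R) C p =
      LinearMap.finsuppLinearMap R (Finsupp.mapRange.linearMap homothety p) := by
    ext c j
    exact TensorProduct.finsuppScalarLeft_apply_tmul_apply p c j
  have h_mapRange : Function.Bijective (Finsupp.mapRange.linearMap (α := J) homothety) :=
    Finsupp.mapRange_bijective _ (map_zero _) h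
  rw [← Function.Bijective.of_comp_iff' (E.congrRight (M := C) (R := R)).bijective]
  convert (LinearMap.finsuppLinearMap_bijective_of_moduleFinite R C C J (S := R)).comp h_mapRange
  exact funext h_coords

lemma bijective_mk_of_leftInverse {s : P →ₗ[R] F} {q : F →ₗ[R] P} (hqs : q ∘ₗ s = LinearMap.id)
    (h : Function.Bijective (TensorProduct.mk R F C)) :
    Function.Bijective (TensorProduct.mk R P C) := by
  refine ⟨fun p p' hp ↦ ?_, fun g ↦ ?_⟩
  · have h_inj : Function.Injective s := Function.LeftInverse.injective (LinearMap.congr_fun hqs)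
    refine h_inj (h.1 (LinearMap.ext fun c ↦ ?_))
    simpa using congr(s.rTensor C ($hp c))
  · obtain ⟨f, hf⟩ := h.2 (s.rTensor C ∘ₗ g)
    refine ⟨q f, LinearMap.ext fun c ↦ ?_⟩
    calc q f ⊗ₜ[R] c = q.rTensor C (s.rTensor C (g c)) := by
          simpa using congr(q.rTensor C ($hf c))
      _ = g c := by rw [← LinearMap.rTensor_comp_apply, hqs, LinearMap.rTensor_id_apply]

lemma bijective_mk_of_projective [Module.Projective R P] [Module.Finite R C]
    (h : Function.Bijective fun r : R ↦ r • (LinearMap.id : C →ₗ[R] C)) :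
    Function.Bijective (TensorProduct.mk R P C) := by
  obtain ⟨s, hs⟩ := Module.projective_def'.1 ‹Module.Projective R P›
  exact bijective_mk_of_leftInverse hs (bijective_mk_finsupp P h)

lemma bijective_rTensor (h : Function.Bijective (TensorProduct.mk R Q C)) :
    Function.Bijective (LinearMap.rTensor C : (P →ₗ[R] Q) → P ⊗[R] C →ₗ[R] Q ⊗[R] C) := by
  let mk_equiv := LinearEquiv.ofBijective (TensorProduct.mk R Q C) h
  convert ((mk_equiv.congrRight (M := P)).trans (TensorProduct.lift.equiv (.id R) P C _)).bijective
  ext φ p c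
  rfl

lemma nonempty_linearEquiv_range_rTensor {φ : P →ₗ[R] P} (hφ : φ ∘ₗ φ = φ)
    {i : M →ₗ[R] P ⊗[R] C} {r : P ⊗[R] C →ₗ[R] M} (hri : r ∘ₗ i = LinearMap.id)
    (hir : i ∘ₗ r = φ.rTensor C) : Nonempty (M ≃ₗ[R] LinearMap.range φ ⊗[R] C) := by
  let ι := (LinearMap.range φ).subtype
  let π := φ.rangeRestrict
  have hιπ : ι ∘ₗ π = φ := rfl
  have hπι : π ∘ₗ ι = LinearMap.id := by
    ext ⟨x, p, rfl⟩
    exact LinearMap.congr_fun hφ p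
  refine ⟨LinearEquiv.ofLinearMap (π.rTensor C ∘ₗ i) (r ∘ₗ ι.rTensor C) ?_ ?_⟩
  · calc (π.rTensor C ∘ₗ i) ∘ₗ r ∘ₗ ι.rTensor C
        = π.rTensor C ∘ₗ (i ∘ₗ r) ∘ₗ ι.rTensor C := rfl
      _ = ((π ∘ₗ ι) ∘ₗ π ∘ₗ ι).rTensor C := by
        rw [hir, ← LinearMap.rTensor_comp, ← LinearMap.rTensor_comp]; rfl
      _ = LinearMap.id := by rw [hπι, LinearMap.id_comp, LinearMap.rTensor_id]
  · calc (r ∘ₗ ι.rTensor C) ∘ₗ π.rTensor C ∘ₗ i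
        = r ∘ₗ (ι.rTensor C ∘ₗ π.rTensor C) ∘ₗ i := rfl
      _ = (r ∘ₗ i) ∘ₗ r ∘ₗ i := by rw [← LinearMap.rTensor_comp, hιπ, ← hir]; rfl
      _ = LinearMap.id := by rw [hri, LinearMap.id_comp]

/-- `- ⊗ C` is fully faithful on projective modules, so an idempotent of `P ⊗ C` comes from one
of `P`. -/
lemma exists_projective_of_retract [Module.Projective R P] [Module.Finite R C]
    (h : Function.Bijective fun r : R ↦ r • (LinearMap.id : C →ₗ[R] C))
    {i : M →ₗ[R] P ⊗[R] C} {r : P ⊗[R] C →ₗ[R] M} (hri : r ∘ₗ i = LinearMap.id) :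
    ∃ Q : Submodule R P, Module.Projective R Q ∧ Nonempty (M ≃ₗ[R] Q ⊗[R] C) := by
  have h_rTensor := bijective_rTensor (P := P) (bijective_mk_of_projective (P := P) h)
  obtain ⟨φ, hφ⟩ := h_rTensor.2 (i ∘ₗ r)
  have hφφ : φ ∘ₗ φ = φ := h_rTensor.1 <|
    calc (φ ∘ₗ φ).rTensor C = i ∘ₗ (r ∘ₗ i) ∘ₗ r := by rw [LinearMap.rTensor_comp, hφ]; rfl
      _ = φ.rTensor C := by rw [hri, LinearMap.id_comp, hφ]
  refine ⟨LinearMap.range φ, .of_split (LinearMap.range φ).subtype φ.rangeRestrict ?_,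
    nonempty_linearEquiv_range_rTensor hφφ hri hφ.symm⟩
  ext ⟨x, p, rfl⟩
  exact LinearMap.congr_fun hφφ p

end LinearAlgebra

section Modules

variable {R : Type u} [CommRing R] {C N : ModuleCat.{u} R}

lemma exists_lift_finsupp {S : ShortComplex (ModuleCat.{u} R)}
    (h : ∀ f : C ⟶ S.X₃, ∃ g : C ⟶ S.X₂, g ≫ S.g = f) {J : Type u}
    (f : ModuleCat.of R (J →₀ C) ⟶ S.X₃) :
    ∃ g : ModuleCat.of R (J →₀ C) ⟶ S.X₂, g ≫ S.g = f := by
  choose g hg using fun j : J ↦ h (ModuleCat.ofHom (f.hom ∘ₗ Finsupp.lsingle j))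
  refine ⟨ModuleCat.ofHom (Finsupp.lsum R fun j ↦ (g j).hom), ?_⟩
  ext j c
  simpa using congr(($(hg j)).hom c)

lemma exists_extension_finsupp {S : ShortComplex (ModuleCat.{u} R)} [Module.Finite R S.X₁]
    (h : ∀ f : S.X₁ ⟶ N, ∃ g : S.X₂ ⟶ N, S.f ≫ g = f) {J : Type u}
    (f : S.X₁ ⟶ ModuleCat.of R (J →₀ N)) :
    ∃ g : S.X₂ ⟶ ModuleCat.of R (J →₀ N), S.f ≫ g = f := by
  obtain ⟨φ, hφ⟩ := (LinearMap.finsuppLinearMap_bijective_of_moduleFinite R S.X₁ N J (S := R)).2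
    f.hom
  have precomp_surjective : Function.Surjective (LinearMap.lcomp R N S.f.hom) := fun k ↦ by
    obtain ⟨g, hg⟩ := h (ModuleCat.ofHom k)
    exact ⟨g.hom, congr(($hg).hom)⟩
  obtain ⟨ψ, rfl⟩ := Finsupp.mapRange_surjective _ (map_zero _) precomp_surjective φ
  refine ⟨ModuleCat.ofHom (LinearMap.finsuppLinearMap R ψ), ModuleCat.hom_ext ?_⟩
  rw [← hφ]
  ext x j
  simp

lemma subsingleton_ext_finsupp_left (J : Type u) {Y : ModuleCat.{u} R} {n : ℕ}
    (h : Subsingleton (Ext.{u} C Y (n + 1))) :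
    Subsingleton (Ext.{u} (ModuleCat.of R (J →₀ C)) Y (n + 1)) := by
  obtain ⟨I⟩ := EnoughInjectives.presentation Y
  have hS := I.shortExact_shortComplex
  induction n generalizing Y with
  | zero =>
    exact subsingleton_ext_one_X₁ hS (exists_lift_finsupp (exists_lift_of_ext_one hS h))
      (Ext.subsingleton_of_injective ..)
  | succ n ih =>
    obtain ⟨I'⟩ := EnoughInjectives.presentation I.shortComplex.X₃
    exact subsingleton_ext_X₁ hS
      (ih (subsingleton_ext_X₃ hS (Ext.subsingleton_of_injective ..) h) I'
        I'.shortExact_shortComplex) (Ext.subsingleton_of_injective ..)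

/-- The syzygies of `X` are finitely generated, so maps out of them commute with direct sums. -/
lemma subsingleton_ext_syzygy_finsupp {M : ModuleCat.{u} R} (X : Resolution (finiteFree R) M)
    (J : Type u) (n k : ℕ) (h : Subsingleton (Ext.{u} (X.syzygy k) N (n + 1))) :
    Subsingleton (Ext.{u} (X.syzygy k) (ModuleCat.of R (J →₀ N)) (n + 1)) := by
  have projective (k : ℕ) : Projective (X.complex.X k) := by
    have : Module.Free R (X.complex.X k) := (X.mem k).1
    infer_instance
  have hS := X.syzygySequence_shortExact k
  induction n generalizing k with
  | zero =>
    have : Module.Finite R (X.complex.X (k + 1)) := (X.mem (k + 1)).2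
    have : Module.Finite R (X.syzygy (k + 1)) :=
      .of_surjective (X.proj (k + 1)).hom ((ModuleCat.epi_iff_surjective _).1 inferInstance)
    exact subsingleton_ext_one_of_X₃ hS
      (exists_extension_finsupp (exists_extension_of_ext_one hS h))
      (Ext.subsingleton_of_projective ..)
  | succ n ih =>
    exact subsingleton_ext_of_X₃ hS
      (ih (k + 1) (subsingleton_ext_of_X₁ hS (Ext.subsingleton_of_projective ..) h)
        (X.syzygySequence_shortExact (k + 1))) (Ext.subsingleton_of_projective ..)

lemma cProjective_exists_retract {M : ModuleCat.{u} R} (hM : cProjective C M) :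
    ∃ J : Type u, Nonempty (Retract M (ModuleCat.of R (J →₀ C))) := by
  classical
  obtain ⟨P, hP, ⟨e⟩⟩ := hM
  obtain ⟨s, hs⟩ := Module.projective_def'.1 hP
  let r : Retract (ModuleCat.of R P) (ModuleCat.of R (P →₀ R)) :=
    { i := ModuleCat.ofHom s
      r := ModuleCat.ofHom (Finsupp.linearCombination R id)
      retract := ModuleCat.hom_ext hs }
  exact ⟨P, ⟨.trans (.ofIso e.toModuleIso) <|
    .trans (r.map (MonoidalCategory.tensorRight C)) <|
    .ofIso (TensorProduct.finsuppScalarLeft R C P).toModuleIso⟩⟩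

instance : (cProjective C).IsClosedUnderIsomorphisms where
  of_iso := by
    rintro X Y e ⟨P, hP, ⟨e'⟩⟩
    exact ⟨P, hP, ⟨e.toLinearEquiv.symm.trans e'⟩⟩

instance : (cProjective C).ContainsZero where
  exists_zero := by
    have : Subsingleton (PUnit.{u + 1} ⊗[R] C) := inferInstance
    exact ⟨ModuleCat.of R (PUnit.{u + 1} ⊗[R] C), ModuleCat.isZero_of_subsingleton _,
      ModuleCat.of R PUnit.{u + 1}, inferInstanceAs (Module.Projective R PUnit.{u + 1}),
      ⟨LinearEquiv.refl R _⟩⟩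

instance : (cProjective C).IsClosedUnderBinaryProducts :=
  isClosedUnderBinaryProducts_of_biprod <| by
    rintro X Y ⟨P, hP, ⟨e⟩⟩ ⟨Q, hQ, ⟨e'⟩⟩
    exact ⟨ModuleCat.of R (P × Q), inferInstanceAs (Module.Projective R (P × Q)),
      ⟨(ModuleCat.biprodIsoProd X Y).toLinearEquiv ≪≫ₗ e.prodCongr e' ≪≫ₗ
        (TensorProduct.prodLeft R R P Q C).symm⟩⟩

namespace IsSemidualizing

variable (hC : IsSemidualizing C)

include hC

lemma finite : Module.Finite R C := by
  obtain ⟨X⟩ := hC.resolution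
  have : Module.Finite R (X.complex.X 0) := (X.mem 0).2
  have epi_ε : Epi X.ε := ((chainComplex_acyclic_iff _).1 X.exact).1
  exact .of_surjective X.ε.hom ((ModuleCat.epi_iff_surjective _).1 epi_ε)

lemma subsingleton_ext_finsupp (J : Type u) (n : ℕ) :
    Subsingleton (Ext.{u} C (ModuleCat.of R (J →₀ C)) (n + 1)) := by
  obtain ⟨X⟩ := hC.resolution
  have h := subsingleton_ext_of_retract_left (hC.ext (n + 1) (by lia)) X.syzygyZeroIso.retract
  exact subsingleton_ext_of_retract_left (subsingleton_ext_syzygy_finsupp X J n 0 h)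
    X.syzygyZeroIso.symm.retract

theorem orthogonal : Orthogonal.{u} (cProjective C) (cProjective C) := by
  refine orthogonal_iff.2 fun X Y hX hY n ↦ ?_
  obtain ⟨J, ⟨r⟩⟩ := cProjective_exists_retract hX
  obtain ⟨J', ⟨r'⟩⟩ := cProjective_exists_retract hY
  exact subsingleton_ext_of_retract_left (subsingleton_ext_of_retract_right
    (subsingleton_ext_finsupp_left J (hC.subsingleton_ext_finsupp J' n)) r') r

theorem cProjective_isStableUnderRetracts : (cProjective C).IsStableUnderRetracts where
  of_retract := by
    rintro X Y r ⟨P, hP, ⟨e⟩⟩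
    have := hC.finite
    have hr : (r.r.hom ∘ₗ e.symm.toLinearMap) ∘ₗ e.toLinearMap ∘ₗ r.i.hom = LinearMap.id := by
      ext x
      have r_retract : r.r.hom (r.i.hom x) = x := congr(($r.retract).hom x)
      simpa using r_retract
    obtain ⟨Q, hQ, ⟨e'⟩⟩ := exists_projective_of_retract hC.homothety hr
    exact ⟨ModuleCat.of R Q, hQ, ⟨e'⟩⟩

end IsSemidualizing

end Modules

end RelTate

theorem theoremC_general {A : Type u} [Category.{v} A] [Abelian A] [HasExt.{w} A]
    {𝒲 : ObjectProperty A} [𝒲.ContainsZero] [𝒲.IsStableUnderRetracts]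
    [𝒲.IsClosedUnderBinaryProducts] (hO : RelTate.Orthogonal.{w} 𝒲 𝒲) (M : A)
    (hM : RelTate.projDim (RelTate.gorenstein 𝒲) M < ⊤) :
    ∃ _ : RelTate.HasTateResolution 𝒲 M,
      List.TFAE [
        RelTate.projDim 𝒲 M < ⊤,
        ∀ (n : ℤ) (X : A) [RelTate.HasTateResolution 𝒲 X], IsZero (RelTate.tateExt 𝒲 n X M),
        ∃ n : ℤ, ∀ (X : A) [RelTate.HasTateResolution 𝒲 X], IsZero (RelTate.tateExt 𝒲 n X M),
        ∀ (n : ℤ) (N : A), IsZero (RelTate.tateExt 𝒲 n M N),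
        ∃ n : ℤ, ∀ N : A, IsZero (RelTate.tateExt 𝒲 n M N),
        IsZero (RelTate.tateExt 𝒲 0 M M)] :=
  have := RelTate.hasTateResolution_of_projDim_gorenstein_lt_top hO hM
  ⟨this, RelTate.tateExt_tfae hO M⟩

theorem theoremC :
    -- the result for modules over a commutative ring
    (∀ (R : Type u) [CommRing R] (C : ModuleCat.{u} R), RelTate.IsSemidualizing C →
      ∀ M : ModuleCat.{u} R,
        RelTate.projDim (RelTate.gorenstein (RelTate.cProjective C)) M < ⊤ →
        ∃ _ : RelTate.HasTateResolution (RelTate.cProjective C) M,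
          List.TFAE [
            RelTate.projDim (RelTate.cProjective C) M < ⊤,
            ∀ (n : ℤ) (X : ModuleCat.{u} R) [RelTate.HasTateResolution (RelTate.cProjective C) X],
              IsZero (RelTate.tateExt (RelTate.cProjective C) n X M),
            ∃ n : ℤ, ∀ (X : ModuleCat.{u} R)
              [RelTate.HasTateResolution (RelTate.cProjective C) X],
              IsZero (RelTate.tateExt (RelTate.cProjective C) n X M),
            ∀ (n : ℤ) (N : ModuleCat.{u} R),
              IsZero (RelTate.tateExt (RelTate.cProjective C) n M N),
            ∃ n : ℤ, ∀ N : ModuleCat.{u} R,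
              IsZero (RelTate.tateExt (RelTate.cProjective C) n M N),
            IsZero (RelTate.tateExt (RelTate.cProjective C) 0 M M)]) ∧
    -- the general form in an abelian category
    (∀ (A : Type u) [Category.{v} A] [Abelian A] [HasExt.{w} A] (𝒲 : ObjectProperty A)
      [𝒲.ContainsZero] [𝒲.IsStableUnderRetracts] [𝒲.IsClosedUnderExtensions],
      RelTate.ClosedUnderKernelsOfEpis 𝒲 → RelTate.Orthogonal.{w} 𝒲 𝒲 →
      ∀ M : A, RelTate.projDim (RelTate.gorenstein 𝒲) M < ⊤ →
        ∃ _ : RelTate.HasTateResolution 𝒲 M,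
          List.TFAE [
            RelTate.projDim 𝒲 M < ⊤,
            ∀ (n : ℤ) (X : A) [RelTate.HasTateResolution 𝒲 X],
              IsZero (RelTate.tateExt 𝒲 n X M),
            ∃ n : ℤ, ∀ (X : A) [RelTate.HasTateResolution 𝒲 X],
              IsZero (RelTate.tateExt 𝒲 n X M),
            ∀ (n : ℤ) (N : A), IsZero (RelTate.tateExt 𝒲 n M N),
            ∃ n : ℤ, ∀ N : A, IsZero (RelTate.tateExt 𝒲 n M N),
            IsZero (RelTate.tateExt 𝒲 0 M M)]) := by
  refine ⟨fun R _ C hC ↦ ?_, fun A _ _ _ 𝒲 _ _ _ _ hO ↦ ?_⟩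
  · have := hC.cProjective_isStableUnderRetracts
    exact theoremC_general hC.orthogonal
  · have : 𝒲.IsClosedUnderBinaryProducts :=
      RelTate.isClosedUnderBinaryProducts_of_biprod fun _ _ ↦ (𝒲.prop_biprod · ·)
    exact theoremC_general hO
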